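/- **Setting.** Let $\mathcal H=\mathbb C^2\otimes\mathbb C^2\otimes\mathbb C^2$, and write $\psi=\sum_{i,j,k=0}^1\psi^{ijk}|ijk\rangle\in\mathcal H$. Let $\varepsilon=\begin{pmatrix}0&1\\-1&0\end{pmatrix}$; repeated indices are summed. In every formula $a,b,c$ are the three different elements of $\{1,2,3\}$, in any order. Put $$[\gamma_1(\psi)]^{ii'}=\varepsilon_{jj'}\varepsilon_{kk'}\psi^{ijk}\psi^{i'j'k'},\quad [\gamma_2(\psi)]^{jj'}=\varepsilon_{kk'}\varepsilon_{ii'}\psi^{ijk}\psi^{i'j'k'},\quad [\gamma_3(\psi)]^{kk'}=\varepsilon_{ii'}\varepsilon_{jj'}\psi^{ijk}\psi^{i'j'k'},$$ $$[T(\psi,\psi,\psi)]^{ijk}=-\varepsilon_{ll'}\varepsilon_{mm'}\varepsilon_{nn'}\psi^{imn}\psi^{lm'n'}\psi^{l'jk},$$ $$q(\psi)=\varepsilon_{ii'}\varepsilon_{jj'}\varepsilon_{kk'}\varepsilon_{ll'}\varepsilon_{mm'}\varepsilon_{nn'}\psi^{ikl}\psi^{jk'l'}\psi^{i'mn}\psi^{j'm'n'},$$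 and, with $\|M\|^2=\operatorname{tr}M^\dagger M$ for matrices, $$n=\|\psi\|^2,\quad g_a=\|\gamma_a(\psi)\|^2,\quad y=\tfrac23(g_1+g_2+g_3),\quad c_a^2=g_b+g_c,\quad t=4\|T(\psi,\psi,\psi)\|^2,\quad \tau^2=4|q(\psi)|^2 .$$ *Classes of vectors.* $\mathcal V_{\rm Null}=\{0\}$. $\mathcal V_{1|2|3}$ is the set of nonzero product vectors $\psi_1\otimes\psi_2\otimes\psi_3$. $\mathcal V_{a|bc}$ is the set of vectors $\psi_a\otimes\psi_{bc}$ with $\psi_a\ne0$ and $\psi_{bc}$ not a product vector. $\mathcal V_{\rm W}$ and $\mathcal V_{\rm GHZ}$ are the $GL(2,\mathbb C)^{\times3}$-orbits of $\frac1{\sqrt3}(|100\rangle+|010\rangle+|001\rangle)$ and of $\frac1{\sqrt2}(|000\rangle+|111\rangle)$. SLOCC equivalence of vectors means lying on the same $GL(2,\mathbb C)^{\times3}$-orbit. *Mixed states.* $\mathcal D$ is the set of density matrices on $\mathcal H$ (positive semidefinite, trace $1$). Let $\mathcal Q_x=\{|\psi\rangle\langle\psi| : \psi\in\mathcal V_x,\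 \|\psi\|=1\}$, and $$\mathcal P_{1|2|3}=\mathcal Q_{1|2|3},\qquad \mathcal P_{a|bc}=\mathcal Q_{1|2|3}\cup\mathcal Q_{a|bc},$$ $$\mathcal P_{\rm W}=\mathcal Q_{1|2|3}\cup\mathcal Q_{1|23}\cup\mathcal Q_{2|13}\cup\mathcal Q_{3|12}\cup\mathcal Q_{\rm W},\qquad \mathcal P_{123}=\mathcal P_{\rm W}\cup\mathcal Q_{\rm GHZ}.$$ Let $\mathcal D_{1|2|3},\mathcal D_{a|bc},\mathcal D_{\rm W},\mathcal D_{123}$ be the convex hulls of $\mathcal P_{1|2|3},\mathcal P_{a|bc},\mathcal P_{\rm W},\mathcal P_{123}$, let $\mathcal D_{b|ac,c|ab}=\operatorname{Conv}(\mathcal P_{b|ac}\cup\mathcal P_{c|ab})$, and let $\mathcal D_{\text{2-sep}}=\operatorname{Conv}(\mathcal P_{1|23}\cup\mathcal P_{2|13}\cup\mathcal P_{3|12})$. The convex roof extension of a function $f$ of pure states is $f^\cup(\varrho)=\min\sum_ip_if(\psi_i)$, over all finite decompositions $\varrho=\sum_ip_i|\psi_i\rangle\langle\psi_i|$ with $p_i\ge0$,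 $\sum_ip_i=1$, $\|\psi_i\|=1$. *PSS classes.* Write $D_a=\mathcal D_{a|bc}$ and $D_{bc}=\mathcal D_{b|ac,c|ab}$. The $1+18+2$ PSS classes are $$\mathcal C_3=\mathcal D_{1|2|3},\qquad \mathcal C_{2.8}=(D_1\cap D_2\cap D_3)\setminus\mathcal D_{1|2|3},$$ $$\mathcal C_{2.7.a}=(D_b\cap D_c)\setminus D_a,\qquad \mathcal C_{2.6.a}=D_a\cap[D_{bc}\setminus(D_b\cup D_c)],\qquad \mathcal C_{2.5.a}=D_a\setminus D_{bc},$$ $$\mathcal C_{2.4}=(D_{23}\cap D_{13}\cap D_{12})\setminus(D_1\cup D_2\cup D_3),\qquad \mathcal C_{2.3.a}=(D_{ac}\cap D_{ab})\setminus(D_a\cup D_{bc}),$$ $$\mathcal C_{2.2.a}=D_{bc}\setminus(D_{ac}\cup D_{ab}),\qquad \mathcal C_{2.1}=\mathcal D_{\text{2-sep}}\setminus(D_{23}\cup D_{13}\cup D_{12}),$$ $$\mathcal C_{\rm W}=\mathcal D_{\rm W}\setminus\mathcal D_{\text{2-sep}},\qquad \mathcal C_{\rm GHZ}=\mathcal D_{123}\setminus\mathcal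 D_{\rm W}.$$ **Theorem.** 1. The functions $y,c_a^2,g_a,t,\tau^2$ are nonnegative and invariant under $U(2)^{\times3}$, and take equal values on $\psi,\varphi$ whenever $|\psi\rangle\langle\psi|=|\varphi\rangle\langle\varphi|$. 2. Every $\psi\in\mathcal H$ lies in exactly one of the seven sets $\mathcal V_x$, and these sets are exactly the SLOCC equivalence classes. For every $\psi\in\mathcal H$, $\psi$ belongs to the class in a row of the following table if and only if its invariants satisfy all the conditions of that row: | class | $n$ | $y$ | $c_a^2$ | $c_b^2,c_c^2$ | $g_a$ | $g_b,g_c$ | $t$ | $\tau^2$ | |---|---|---|---|---|---|---|---|---| | $\mathcal V_{\rm Null}$ | $=0$ | $=0$ | $=0$ | $=0$ | $=0$ | $=0$ | $=0$ | $=0$ | | $\mathcal V_{1\vert2\vert3}$ | $>0$ | $=0$ | $=0$ | $=0$ | $=0$ | $=0$ | $=0$ | $=0$ | | $\mathcal V_{a\vert bc}$ | $>0$ | $>0$ | $=0$ | $>0$ | $>0$ | $=0$ | $=0$ | $=0$ | | $\mathcal V_{\rm W}$ | $>0$ | $>0$ | $>0$ | $>0$ | $>0$ | $>0$ | $>0$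 | $=0$ | | $\mathcal V_{\rm GHZ}$ | $>0$ | $>0$ | $>0$ | $>0$ | $>0$ | $>0$ | $>0$ | $>0$ | 3. For every $\varrho\in\mathcal D$ the minima defining $y^\cup(\varrho),(c_a^2)^\cup(\varrho),g_a^\cup(\varrho),t^\cup(\varrho),(\tau^2)^\cup(\varrho)$ exist, and $$\varrho\in\mathcal D_{1|2|3}\iff y^\cup(\varrho)=0,\qquad \varrho\in\mathcal D_{a|bc}\iff (c_a^2)^\cup(\varrho)=0,\qquad \varrho\in\mathcal D_{b|ac,c|ab}\iff g_a^\cup(\varrho)=0,$$ $$\varrho\in\mathcal D_{\text{2-sep}}\iff t^\cup(\varrho)=0,\qquad \varrho\in\mathcal D_{\rm W}\iff (\tau^2)^\cup(\varrho)=0 .$$ 4. Every $\varrho\in\mathcal D$ belongs to exactly one of the 21 PSS classes (some of which might be empty), and $\varrho$ belongs to the class in a row of the following table if and only if its convex roofs satisfy all the conditions of that row: | class | $y^\cup$ | $(c_a^2)^\cup$ | $(c_b^2)^\cup,(c_c^2)^\cup$ | $g_a^\cup$ | $g_b^\cup,g_c^\cup$ | $t^\cup$ | $(\tau^2)^\cup$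 | |---|---|---|---|---|---|---|---| | $\mathcal C_3$ | $=0$ | $=0$ | $=0$ | $=0$ | $=0$ | $=0$ | $=0$ | | $\mathcal C_{2.8}$ | $>0$ | $=0$ | $=0$ | $=0$ | $=0$ | $=0$ | $=0$ | | $\mathcal C_{2.7.a}$ | $>0$ | $>0$ | $=0$ | $=0$ | $=0$ | $=0$ | $=0$ | | $\mathcal C_{2.6.a}$ | $>0$ | $=0$ | $>0$ | $=0$ | $=0$ | $=0$ | $=0$ | | $\mathcal C_{2.5.a}$ | $>0$ | $=0$ | $>0$ | $>0$ | $=0$ | $=0$ | $=0$ | | $\mathcal C_{2.4}$ | $>0$ | $>0$ | $>0$ | $=0$ | $=0$ | $=0$ | $=0$ | | $\mathcal C_{2.3.a}$ | $>0$ | $>0$ | $>0$ | $>0$ | $=0$ | $=0$ | $=0$ | | $\mathcal C_{2.2.a}$ | $>0$ | $>0$ | $>0$ | $=0$ | $>0$ | $=0$ | $=0$ | | $\mathcal C_{2.1}$ | $>0$ | $>0$ | $>0$ | $>0$ | $>0$ | $=0$ | $=0$ | | $\mathcal C_{\rm W}$ | $>0$ | $>0$ | $>0$ | $>0$ | $>0$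 | $>0$ | $=0$ | | $\mathcal C_{\rm GHZ}$ | $>0$ | $>0$ | $>0$ | $>0$ | $>0$ | $>0$ | $>0$ | -/

import Mathlib

namespace ThreeQubit

open scoped Kronecker ComplexOrder

noncomputable section

/-! ### State vectors and local operators -/

/-- The basis labels `(i, j, k)` of three qubits. -/
abbrev Idx : Type := Fin 2 × Fin 2 × Fin 2

/-- The three-qubit Hilbert space `ℂ² ⊗ ℂ² ⊗ ℂ²`; the coefficient `ψ^{ijk}` is `ψ (i, j, k)`. -/
abbrev Vec : Type := EuclideanSpace ℂ Idx

/-- The vector `(A ⊗ B ⊗ C) ψ`. -/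
def localAct (A B C : Matrix (Fin 2) (Fin 2) ℂ) (ψ : Vec) : Vec :=
  WithLp.toLp 2 ((A ⊗ₖ (B ⊗ₖ C)).mulVec ψ.ofLp)

/-- SLOCC equivalence of state vectors: being on the same orbit of `GL(2, ℂ)^{×3}`. -/
def SLOCCEquiv (ψ φ : Vec) : Prop :=
  ∃ A B C : GL (Fin 2) ℂ, φ = localAct A.val B.val C.val ψ

/-- The product vector `u ⊗ v ⊗ w`. -/
def tensor3 (u v w : Fin 2 → ℂ) : Vec :=
  WithLp.toLp 2 fun x => u x.1 * v x.2.1 * w x.2.2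

/-- The vector `u ⊗ v` with `u` on the qubit `a` (the qubits are numbered `0, 1, 2`), and `v` on
the two other qubits, taken in increasing order. -/
def tensor12 : Fin 3 → (Fin 2 → ℂ) → (Fin 2 → Fin 2 → ℂ) → Vec
  | 0, u, v => WithLp.toLp 2 fun x => u x.1 * v x.2.1 x.2.2
  | 1, u, v => WithLp.toLp 2 fun x => u x.2.1 * v x.1 x.2.2
  | 2, u, v => WithLp.toLp 2 fun x => u x.2.2 * v x.1 x.2.1

/-- A two-qubit vector is separable if it is a product vector. -/
def IsProduct2 (v : Fin 2 → Fin 2 → ℂ) : Prop :=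
  ∃ s t : Fin 2 → ℂ, ∀ i j, v i j = s i * t j

/-- The standard W state `(|100⟩ + |010⟩ + |001⟩) / √3`. -/
def stateW : Vec :=
  WithLp.toLp 2 fun x =>
    if x = (1, 0, 0) ∨ x = (0, 1, 0) ∨ x = (0, 0, 1) then ((1 / Real.sqrt 3 : ℝ) : ℂ) else 0

/-- The standard GHZ state `(|000⟩ + |111⟩) / √2`. -/
def stateGHZ : Vec :=
  WithLp.toLp 2 fun x =>
    if x = (0, 0, 0) ∨ x = (1, 1, 1) then ((1 / Real.sqrt 2 : ℝ) : ℂ) else 0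

/-- Labels of the `1 + 1 + 3 + 1 + 1` SLOCC classes of three-qubit vectors. -/
inductive SLOCCLabel : Type
  | null
  | sep
  | bisep (a : Fin 3)
  | W
  | GHZ

/-- The SLOCC classes `V_Null`, `V_{1|2|3}`, `V_{a|bc}`, `V_W`, `V_GHZ`. -/
def sloccClass : SLOCCLabel → Set Vec
  | .null => {0}
  | .sep => {ψ | ψ ≠ 0 ∧ ∃ u v w, ψ = tensor3 u v w}
  | .bisep a => {ψ | ∃ u v, u ≠ 0 ∧ ¬ IsProduct2 v ∧ ψ = tensor12 a u v}
  | .W => {ψ | SLOCCEquiv stateW ψ}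
  | .GHZ => {ψ | SLOCCEquiv stateGHZ ψ}

/-! ### The covariants of the Freudenthal triple system and the indicator functions -/

/-- The invariant antisymmetric form `ε`. -/
def eps : Matrix (Fin 2) (Fin 2) ℂ := !![0, 1; -1, 0]

/-- The covariants `γ_1(ψ), γ_2(ψ), γ_3(ψ)`. -/
def gam : Fin 3 → Vec → Matrix (Fin 2) (Fin 2) ℂ
  | 0, ψ => fun i i' =>
      ∑ j, ∑ j', ∑ k, ∑ k', eps j j' * eps k k' * ψ (i, j, k) * ψ (i', j', k')
  | 1, ψ => fun j j' =>
      ∑ k, ∑ k', ∑ i, ∑ i', eps k k' * eps i i' * ψ (i, j, k) * ψ (i', j', k')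
  | 2, ψ => fun k k' =>
      ∑ i, ∑ i', ∑ j, ∑ j', eps i i' * eps j j' * ψ (i, j, k) * ψ (i', j', k')

/-- The covariant `T(ψ,ψ,ψ)^{ijk} = - ε_{ll'} ε_{mm'} ε_{nn'} ψ^{imn} ψ^{lm'n'} ψ^{l'jk}`, with the
sums over `m, m', n, n'` collected in `γ_1(ψ)^{il}`. -/
def T (ψ : Vec) : Vec :=
  WithLp.toLp 2 fun x => - ∑ l, ∑ l', eps l l' * gam 0 ψ x.1 l * ψ (l', x.2.1, x.2.2)

/-- The invariant
`q(ψ) = ε_{ii'} ε_{jj'} ε_{kk'} ε_{ll'} ε_{mm'} ε_{nn'} ψ^{ikl} ψ^{jk'l'} ψ^{i'mn} ψ^{j'm'n'}`,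
with the sums over `k, k', l, l'` collected in `γ_1(ψ)^{ij}`, and those over `m, m', n, n'` in
`γ_1(ψ)^{i'j'}`. -/
def q (ψ : Vec) : ℂ :=
  ∑ i, ∑ i', ∑ j, ∑ j', eps i i' * eps j j' * gam 0 ψ i j * gam 0 ψ i' j'

/-- `n(ψ) = ‖ψ‖²`. -/
def n (ψ : Vec) : ℝ := ‖ψ‖ ^ 2

/-- `g_a(ψ) = ‖γ_a(ψ)‖²`, with `‖M‖² = tr (M† M) = ∑ |M_{ij}|²`. -/
def g (a : Fin 3) (ψ : Vec) : ℝ := ∑ i, ∑ j, ‖gam a ψ i j‖ ^ 2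

/-- `y = (2/3) (g_1 + g_2 + g_3)`. -/
def y (ψ : Vec) : ℝ := 2 / 3 * (g 0 ψ + g 1 ψ + g 2 ψ)

/-- `c_a² = g_b + g_c` where `{a, b, c}` are the three qubits (addition in `Fin 3` is cyclic). -/
def csq (a : Fin 3) (ψ : Vec) : ℝ := g (a + 1) ψ + g (a + 2) ψ

/-- `t(ψ) = 4 ‖T(ψ,ψ,ψ)‖²`. -/
def t (ψ : Vec) : ℝ := 4 * ‖T ψ‖ ^ 2

/-- `τ²(ψ) = 4 |q(ψ)|²`. -/
def tauSq (ψ : Vec) : ℝ := 4 * ‖q ψ‖ ^ 2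

/-- The nine functions `y`, `c_a²`, `g_a`, `t`, `τ²`. -/
def indicators : Set (Vec → ℝ) :=
  {y, t, tauSq} ∪ Set.range csq ∪ Set.range g

/-! ### Mixed states and the convex roof extension -/

/-- The states of three qubits: positive semidefinite matrices of trace one. -/
def states : Set (Matrix Idx Idx ℂ) := {ρ | ρ.PosSemidef ∧ ρ.trace = 1}

/-- The operator `|ψ⟩⟨ψ|`. -/
def proj (ψ : Vec) : Matrix Idx Idx ℂ := Matrix.vecMulVec ψ.ofLp (star ψ.ofLp)

/-- The averages `∑ p_i f(ψ_i)` over all the decompositions `ρ = ∑ p_i |ψ_i⟩⟨ψ_i|` of `ρ` into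
finitely many pure states, with normalized `ψ_i`. -/
def roofValues (f : Vec → ℝ) (ρ : Matrix Idx Idx ℂ) : Set ℝ :=
  {r | ∃ (m : ℕ) (p : Fin m → ℝ) (ψ : Fin m → Vec),
      (∀ i, 0 ≤ p i) ∧ ∑ i, p i = 1 ∧ (∀ i, ‖ψ i‖ = 1) ∧
      ρ = ∑ i, p i • proj (ψ i) ∧ r = ∑ i, p i * f (ψ i)}

/-- The convex roof extension of `f`. -/
def roof (f : Vec → ℝ) (ρ : Matrix Idx Idx ℂ) : ℝ := sInf (roofValues f ρ)

/-! ### PSS subsets and PSS classes -/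

/-- The pure PSS classes `Q`: the pure states given by the unit vectors of an SLOCC class. -/
def Q (l : SLOCCLabel) : Set (Matrix Idx Idx ℂ) :=
  {π | ∃ ψ ∈ sloccClass l, ‖ψ‖ = 1 ∧ π = proj ψ}

/-- `P_{1|2|3}`. -/
def PSep : Set (Matrix Idx Idx ℂ) := Q .sep

/-- `P_{a|bc}`. -/
def PBisep (a : Fin 3) : Set (Matrix Idx Idx ℂ) := Q .sep ∪ Q (.bisep a)

/-- `P_W`. -/
def PW : Set (Matrix Idx Idx ℂ) := Q .sep ∪ (⋃ a, Q (.bisep a)) ∪ Q .W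

/-- `P_GHZ = P_{123}`. -/
def PGHZ : Set (Matrix Idx Idx ℂ) := Q .sep ∪ (⋃ a, Q (.bisep a)) ∪ Q .W ∪ Q .GHZ

/-- `D_{1|2|3}`. -/
def DSep : Set (Matrix Idx Idx ℂ) := convexHull ℝ PSep

/-- `D_{a|bc}`. -/
def DBisep (a : Fin 3) : Set (Matrix Idx Idx ℂ) := convexHull ℝ (PBisep a)

/-- `D_{b|ac,c|ab}` where `b, c` are the two qubits other than `a`. -/
def DPair (a : Fin 3) : Set (Matrix Idx Idx ℂ) :=
  convexHull ℝ (PBisep (a + 1) ∪ PBisep (a + 2))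

/-- `D_{1|23,2|13,3|12}`, the 2-separable states. -/
def DTwoSep : Set (Matrix Idx Idx ℂ) := convexHull ℝ (⋃ a, PBisep a)

/-- `D_W`. -/
def DW : Set (Matrix Idx Idx ℂ) := convexHull ℝ PW

/-- `D_{123} = D_GHZ`. -/
def DGHZ : Set (Matrix Idx Idx ℂ) := convexHull ℝ PGHZ

/-- Labels of the `1 + 18 + 2` PSS classes. -/
inductive PSSLabel : Type
  | c3
  | c28
  | c27 (a : Fin 3)
  | c26 (a : Fin 3)
  | c25 (a : Fin 3)
  | c24
  | c23 (a : Fin 3)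
  | c22 (a : Fin 3)
  | c21
  | W
  | GHZ

/-- The PSS classes `C_3`, `C_{2.8}`, `C_{2.7.a}`, …, `C_{2.1}`, `C_W`, `C_GHZ` of mixed states. -/
def pssClass : PSSLabel → Set (Matrix Idx Idx ℂ)
  | .c3 => DSep
  | .c28 => (DBisep 0 ∩ DBisep 1 ∩ DBisep 2) \ DSep
  | .c27 a => (DBisep (a + 1) ∩ DBisep (a + 2)) \ DBisep a
  | .c26 a => DBisep a ∩ (DPair a \ (DBisep (a + 1) ∪ DBisep (a + 2)))
  | .c25 a => DBisep a \ DPair a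
  | .c24 => (DPair 0 ∩ DPair 1 ∩ DPair 2) \ (DBisep 0 ∪ DBisep 1 ∪ DBisep 2)
  | .c23 a => (DPair (a + 1) ∩ DPair (a + 2)) \ (DBisep a ∪ DPair a)
  | .c22 a => DPair a \ (DPair (a + 1) ∪ DPair (a + 2))
  | .c21 => DTwoSep \ (DPair 0 ∪ DPair 1 ∪ DPair 2)
  | .W => DW \ DTwoSep
  | .GHZ => DGHZ \ DW

end

end ThreeQubit

namespace ThreeQubit

open scoped Kronecker ComplexOrder

noncomputable section

open Matrix

/-! ### Local operators -/

/-! For vectors, everything rests on covariance. A local operator acts on `gam a` by an invertible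
congruence times determinants, on `T` by itself times determinants, and on `q` by a nonzero scalar
(`gam_zero_localAct`, `T_localAct`, `q_localAct`). Whether each covariant vanishes is therefore
constant on `GL(2, ℂ)^{×3}`-orbits, while unitaries contribute only phases and isometries, which
gives the invariance of the indicators.

Each of the seven sets is the orbit of one canonical vector (`mem_sloccClass_iff`). They exhaust the
space because the pencil spanned by the two slices of `ψ` along the first qubit contains a singular
matrix: this gives a slice of rank at most one, from which normal forms can be read off
(`exists_mem_sloccClass`). Evaluation at the canonical vectors shows that the vanishing patterns of
the covariants differ from class to class, so the pattern determines the class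
(`mem_sloccClass_iff_hasProfile`).

For mixed states, the values of averages over decompositions are a slice of the convex hull of the
compact graph `{(proj ψ, f ψ)}`. The minimum is thus attained, and for `f ≥ 0` it is zero exactly
when some decomposition uses only zeros of `f` (`mem_convexHull_iff_roof_eq_zero`). On unit vectors
the zero sets of the indicators are exactly the unions of classes that generate the PSS subsets. The
PSS classes and their table then follow from the inclusions among these subsets by propositional
logic. -/

theorem localAct_apply (A B C : Matrix (Fin 2) (Fin 2) ℂ) (ψ : Vec) (i j k : Fin 2) :
    localAct A B C ψ (i, j, k) =
      ∑ i', ∑ j', ∑ k', A i i' * (B j j' * C k k') * ψ (i', j', k') := by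
  simp only [localAct, Matrix.mulVec, dotProduct, Fintype.sum_prod_type, Matrix.kroneckerMap_apply]

theorem localAct_mul (A B C A' B' C' : Matrix (Fin 2) (Fin 2) ℂ) (ψ : Vec) :
    localAct (A * A') (B * B') (C * C') ψ = localAct A B C (localAct A' B' C' ψ) := by
  simp [localAct, Matrix.mul_kronecker_mul, Matrix.mulVec_mulVec]

@[simp]
theorem localAct_one (ψ : Vec) : localAct 1 1 1 ψ = ψ := by
  simp [localAct]

/-- Polynomial identities in three matrices become three small identities, each involving the
entries of a single matrix. -/
theorem localAct_eq_comp (A B C : Matrix (Fin 2) (Fin 2) ℂ) (ψ : Vec) :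
    localAct A B C ψ = localAct A 1 1 (localAct 1 B 1 (localAct 1 1 C ψ)) := by
  simp [← localAct_mul]

theorem localAct_smul (A B C : Matrix (Fin 2) (Fin 2) ℂ) (c : ℂ) (ψ : Vec) :
    localAct A B C (c • ψ) = c • localAct A B C ψ := by
  simp [localAct, Matrix.mulVec_smul]

theorem localAct_zero (A B C : Matrix (Fin 2) (Fin 2) ℂ) : localAct A B C 0 = 0 := by
  simp [localAct]

theorem localAct_fst_apply (A : Matrix (Fin 2) (Fin 2) ℂ) (ψ : Vec) (i j k : Fin 2) :
    localAct A 1 1 ψ (i, j, k) = A i 0 * ψ (0, j, k) + A i 1 * ψ (1, j, k) := by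
  rw [localAct_apply]
  simp [Matrix.one_apply, Fin.sum_univ_two]

theorem localAct_snd_apply (B : Matrix (Fin 2) (Fin 2) ℂ) (ψ : Vec) (i j k : Fin 2) :
    localAct 1 B 1 ψ (i, j, k) = B j 0 * ψ (i, 0, k) + B j 1 * ψ (i, 1, k) := by
  rw [localAct_apply]
  simp [Matrix.one_apply, Fin.sum_univ_two]

theorem localAct_trd_apply (C : Matrix (Fin 2) (Fin 2) ℂ) (ψ : Vec) (i j k : Fin 2) :
    localAct 1 1 C ψ (i, j, k) = C k 0 * ψ (i, j, 0) + C k 1 * ψ (i, j, 1) := by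
  rw [localAct_apply]
  simp [Matrix.one_apply, Fin.sum_univ_two]

theorem SLOCCEquiv.refl (ψ : Vec) : SLOCCEquiv ψ ψ := ⟨1, 1, 1, by simp⟩

theorem SLOCCEquiv.symm {ψ φ : Vec} (h : SLOCCEquiv ψ φ) : SLOCCEquiv φ ψ := by
  obtain ⟨A, B, C, rfl⟩ := h
  refine ⟨A⁻¹, B⁻¹, C⁻¹, ?_⟩
  rw [← localAct_mul]
  simp only [← Units.val_mul, inv_mul_cancel, Units.val_one, localAct_one]

theorem SLOCCEquiv.trans {ψ φ χ : Vec} (h : SLOCCEquiv ψ φ) (h' : SLOCCEquiv φ χ) :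
    SLOCCEquiv ψ χ := by
  obtain ⟨A, B, C, rfl⟩ := h
  obtain ⟨A', B', C', rfl⟩ := h'
  exact ⟨A' * A, B' * B, C' * C, by simp [localAct_mul]⟩

theorem SLOCCEquiv.of_det_ne_zero {A B C : Matrix (Fin 2) (Fin 2) ℂ} (hA : A.det ≠ 0)
    (hB : B.det ≠ 0) (hC : C.det ≠ 0) (ψ : Vec) : SLOCCEquiv ψ (localAct A B C ψ) :=
  ⟨GeneralLinearGroup.mkOfDetNeZero A hA, GeneralLinearGroup.mkOfDetNeZero B hB,
    GeneralLinearGroup.mkOfDetNeZero C hC, rfl⟩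

/-! ### Covariance of `γ_a`, `T` and `q` -/

theorem gam_zero_apply (ψ : Vec) (i i' : Fin 2) :
    gam 0 ψ i i' = ψ (i, 0, 0) * ψ (i', 1, 1) - ψ (i, 0, 1) * ψ (i', 1, 0)
      - ψ (i, 1, 0) * ψ (i', 0, 1) + ψ (i, 1, 1) * ψ (i', 0, 0) := by
  simp [gam, eps]; ring

theorem gam_one_apply (ψ : Vec) (j j' : Fin 2) :
    gam 1 ψ j j' = ψ (0, j, 0) * ψ (1, j', 1) - ψ (0, j, 1) * ψ (1, j', 0)
      - ψ (1, j, 0) * ψ (0, j', 1) + ψ (1, j, 1) * ψ (0, j', 0) := by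
  simp [gam, eps]; ring

theorem gam_two_apply (ψ : Vec) (k k' : Fin 2) :
    gam 2 ψ k k' = ψ (0, 0, k) * ψ (1, 1, k') - ψ (0, 1, k) * ψ (1, 0, k')
      - ψ (1, 0, k) * ψ (0, 1, k') + ψ (1, 1, k) * ψ (0, 0, k') := by
  simp [gam, eps]; ring

theorem T_apply (ψ : Vec) (i j k : Fin 2) :
    T ψ (i, j, k) = gam 0 ψ i 1 * ψ (0, j, k) - gam 0 ψ i 0 * ψ (1, j, k) := by
  simp [T, eps]; ring

theorem q_eq (ψ : Vec) :
    q ψ = gam 0 ψ 0 0 * gam 0 ψ 1 1 - gam 0 ψ 0 1 * gam 0 ψ 1 0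
      - gam 0 ψ 1 0 * gam 0 ψ 0 1 + gam 0 ψ 1 1 * gam 0 ψ 0 0 := by
  simp [q, eps]; ring

/-- The free indices carry `A`; each contracted pair carries `Bᵀ ε B = det B • ε`, hence the
determinants of the other two factors. -/
theorem gam_zero_localAct (A B C : Matrix (Fin 2) (Fin 2) ℂ) (ψ : Vec) :
    gam 0 (localAct A B C ψ) = (B.det * C.det) • (A * gam 0 ψ * Aᵀ) := by
  rw [localAct_eq_comp]
  have h1 : ∀ φ, gam 0 (localAct A 1 1 φ) = A * gam 0 φ * Aᵀ := fun φ => by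
    ext i i'
    simp only [gam_zero_apply, localAct_fst_apply, Matrix.mul_apply, Fin.sum_univ_two,
      Matrix.transpose_apply]
    ring
  have h2 : ∀ φ, gam 0 (localAct 1 B 1 φ) = B.det • gam 0 φ := fun φ => by
    ext i i'
    simp only [gam_zero_apply, localAct_snd_apply, Matrix.det_fin_two, Matrix.smul_apply,
      smul_eq_mul]
    ring
  have h3 : ∀ φ, gam 0 (localAct 1 1 C φ) = C.det • gam 0 φ := fun φ => by
    ext i i'
    simp only [gam_zero_apply, localAct_trd_apply, Matrix.det_fin_two, Matrix.smul_apply,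
      smul_eq_mul]
    ring
  rw [h1, h2, h3]
  simp [smul_smul]

theorem gam_one_localAct (A B C : Matrix (Fin 2) (Fin 2) ℂ) (ψ : Vec) :
    gam 1 (localAct A B C ψ) = (A.det * C.det) • (B * gam 1 ψ * Bᵀ) := by
  rw [localAct_eq_comp]
  have h1 : ∀ φ, gam 1 (localAct A 1 1 φ) = A.det • gam 1 φ := fun φ => by
    ext i i'
    simp only [gam_one_apply, localAct_fst_apply, Matrix.det_fin_two, Matrix.smul_apply,
      smul_eq_mul]
    ring
  have h2 : ∀ φ, gam 1 (localAct 1 B 1 φ) = B * gam 1 φ * Bᵀ := fun φ => by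
    ext i i'
    simp only [gam_one_apply, localAct_snd_apply, Matrix.mul_apply, Fin.sum_univ_two,
      Matrix.transpose_apply]
    ring
  have h3 : ∀ φ, gam 1 (localAct 1 1 C φ) = C.det • gam 1 φ := fun φ => by
    ext i i'
    simp only [gam_one_apply, localAct_trd_apply, Matrix.det_fin_two, Matrix.smul_apply,
      smul_eq_mul]
    ring
  rw [h1, h2, h3]
  simp [smul_smul]

theorem gam_two_localAct (A B C : Matrix (Fin 2) (Fin 2) ℂ) (ψ : Vec) :
    gam 2 (localAct A B C ψ) = (A.det * B.det) • (C * gam 2 ψ * Cᵀ) := by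
  rw [localAct_eq_comp]
  have h1 : ∀ φ, gam 2 (localAct A 1 1 φ) = A.det • gam 2 φ := fun φ => by
    ext i i'
    simp only [gam_two_apply, localAct_fst_apply, Matrix.det_fin_two, Matrix.smul_apply,
      smul_eq_mul]
    ring
  have h2 : ∀ φ, gam 2 (localAct 1 B 1 φ) = B.det • gam 2 φ := fun φ => by
    ext i i'
    simp only [gam_two_apply, localAct_snd_apply, Matrix.det_fin_two, Matrix.smul_apply,
      smul_eq_mul]
    ring
  have h3 : ∀ φ, gam 2 (localAct 1 1 C φ) = C * gam 2 φ * Cᵀ := fun φ => by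
    ext i i'
    simp only [gam_two_apply, localAct_trd_apply, Matrix.mul_apply, Fin.sum_univ_two,
      Matrix.transpose_apply]
    ring
  rw [h1, h2, h3]
  simp [smul_smul]

theorem T_localAct (A B C : Matrix (Fin 2) (Fin 2) ℂ) (ψ : Vec) :
    T (localAct A B C ψ) = (A.det * B.det * C.det) • localAct A B C (T ψ) := by
  rw [localAct_eq_comp A B C ψ, localAct_eq_comp A B C (T ψ)]
  have h1 : ∀ φ, T (localAct A 1 1 φ) = A.det • localAct A 1 1 (T φ) := fun φ => by
    ext ⟨i, j, k⟩
    simp only [T_apply, gam_zero_localAct, localAct_fst_apply, Matrix.det_fin_two, PiLp.smul_apply,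
      Matrix.smul_apply, smul_eq_mul, Matrix.mul_apply, Fin.sum_univ_two, Matrix.transpose_apply]
    simp
    ring
  have h2 : ∀ φ, T (localAct 1 B 1 φ) = B.det • localAct 1 B 1 (T φ) := fun φ => by
    ext ⟨i, j, k⟩
    simp only [T_apply, gam_zero_localAct, localAct_snd_apply, PiLp.smul_apply,
      Matrix.smul_apply, smul_eq_mul, Matrix.one_mul, Matrix.transpose_one, Matrix.mul_one,
      Matrix.det_one]
    ring
  have h3 : ∀ φ, T (localAct 1 1 C φ) = C.det • localAct 1 1 C (T φ) := fun φ => by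
    ext ⟨i, j, k⟩
    simp only [T_apply, gam_zero_localAct, localAct_trd_apply, PiLp.smul_apply,
      Matrix.smul_apply, smul_eq_mul, Matrix.one_mul, Matrix.transpose_one, Matrix.mul_one,
      Matrix.det_one]
    ring
  rw [h1, h2, h3]
  simp only [localAct_smul, smul_smul, mul_assoc]

/-- By `q_eq`, `q` is twice the determinant of `gam 0`, so the congruence by `A` gives `(det A)²`
and the scalar `det B * det C` is squared. -/
theorem q_localAct (A B C : Matrix (Fin 2) (Fin 2) ℂ) (ψ : Vec) :
    q (localAct A B C ψ) = (A.det * B.det * C.det) ^ 2 * q ψ := by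
  simp only [q_eq, gam_zero_localAct, Matrix.smul_apply, smul_eq_mul, Matrix.mul_apply,
    Fin.sum_univ_two, Matrix.transpose_apply, Matrix.det_fin_two A]
  ring

/-! ### Homogeneity of `γ_a`, `T` and `q` -/

theorem gam_smul (c : ℂ) (ψ : Vec) (a : Fin 3) : gam a (c • ψ) = c ^ 2 • gam a ψ := by
  ext i j
  fin_cases a
  all_goals
    simp [gam_zero_apply, gam_one_apply, gam_two_apply]
    ring

theorem T_smul (c : ℂ) (ψ : Vec) : T (c • ψ) = c ^ 3 • T ψ := by
  ext ⟨i, j, k⟩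
  simp [T_apply, gam_smul]
  ring

theorem q_smul (c : ℂ) (ψ : Vec) : q (c • ψ) = c ^ 4 * q ψ := by
  simp [q_eq, gam_smul]
  ring

/-! ### Unitary invariance -/

theorem sum_norm_sq_eq_trace (M : Matrix (Fin 2) (Fin 2) ℂ) :
    ((∑ i, ∑ j, ‖M i j‖ ^ 2 : ℝ) : ℂ) = (M * Mᴴ).trace := by
  simp [Matrix.trace, Matrix.mul_apply, ← Complex.mul_conj']

/-- The right factor is `Uᵀ` rather than `Uᴴ`, but the transpose of a unitary is again unitary, so
the Hilbert–Schmidt norm is still preserved. -/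
theorem sum_norm_sq_unitary_conj {U : Matrix (Fin 2) (Fin 2) ℂ}
    (hU : U ∈ Matrix.unitaryGroup (Fin 2) ℂ) (M : Matrix (Fin 2) (Fin 2) ℂ) {c : ℂ}
    (hc : ‖c‖ = 1) :
    ∑ i, ∑ j, ‖(c • (U * M * Uᵀ)) i j‖ ^ 2 = ∑ i, ∑ j, ‖M i j‖ ^ 2 := by
  have h1 : ∀ i j, ‖(c • (U * M * Uᵀ)) i j‖ = ‖(U * M * Uᵀ) i j‖ := by simp [hc]
  simp only [h1]
  apply Complex.ofReal_injective
  have hU1 : Uᴴ * U = 1 := by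
    simpa [Matrix.star_eq_conjTranspose] using Matrix.mem_unitaryGroup_iff'.1 hU
  have hU2 : Uᵀ * Uᵀᴴ = 1 := by
    have := congrArg Matrix.transpose hU1
    rwa [Matrix.transpose_mul, Matrix.transpose_one] at this
  rw [sum_norm_sq_eq_trace, sum_norm_sq_eq_trace, Matrix.conjTranspose_mul,
    Matrix.conjTranspose_mul]
  calc (U * M * Uᵀ * (Uᵀᴴ * (Mᴴ * Uᴴ))).trace
      = (U * M * (Uᵀ * Uᵀᴴ) * Mᴴ * Uᴴ).trace := by simp only [Matrix.mul_assoc]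
    _ = (U * (M * Mᴴ) * Uᴴ).trace := by rw [hU2]; simp only [Matrix.mul_assoc, Matrix.one_mul]
    _ = (M * Mᴴ).trace := by rw [Matrix.trace_mul_comm, ← Matrix.mul_assoc, hU1, Matrix.one_mul]

theorem norm_det_unitary (U : Matrix.unitaryGroup (Fin 2) ℂ) : ‖U.val.det‖ = 1 :=
  CStarRing.norm_of_mem_unitary (Matrix.det_of_mem_unitary U.2)

theorem norm_localAct_unitary (U V W : Matrix.unitaryGroup (Fin 2) ℂ) (ψ : Vec) :
    ‖localAct U.val V.val W.val ψ‖ = ‖ψ‖ := by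
  have hM : (U.val ⊗ₖ (V.val ⊗ₖ W.val)) ∈ Matrix.unitaryGroup Idx ℂ :=
    Matrix.kronecker_mem_unitary U.2 (Matrix.kronecker_mem_unitary V.2 W.2)
  have h := Matrix.mem_unitaryGroup_iff'.1 hM
  rw [Matrix.star_eq_conjTranspose] at h
  have key : ∀ φ : Vec, ((‖φ‖ ^ 2 : ℝ) : ℂ) = star φ.ofLp ⬝ᵥ φ.ofLp := fun φ => by
    rw [EuclideanSpace.norm_sq_eq]
    simp [dotProduct, ← Complex.conj_mul']
  have h2 : ‖localAct U.val V.val W.val ψ‖ ^ 2 = ‖ψ‖ ^ 2 := by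
    apply Complex.ofReal_injective
    rw [key, key]
    simp only [localAct]
    rw [Matrix.star_mulVec, ← Matrix.dotProduct_mulVec, Matrix.mulVec_mulVec, h, Matrix.one_mulVec]
  exact (sq_eq_sq₀ (norm_nonneg _) (norm_nonneg _)).1 h2

theorem g_localAct_unitary (a : Fin 3) (U V W : Matrix.unitaryGroup (Fin 2) ℂ) (ψ : Vec) :
    g a (localAct U.val V.val W.val ψ) = g a ψ := by
  have h : ∀ U V : Matrix.unitaryGroup (Fin 2) ℂ, ‖U.val.det * V.val.det‖ = 1 := fun U V => by
    rw [norm_mul, norm_det_unitary, norm_det_unitary, one_mul]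
  fin_cases a
  · simp only [g, Fin.zero_eta, gam_zero_localAct]
    exact sum_norm_sq_unitary_conj U.2 _ (h _ _)
  · simp only [g, Fin.mk_one, gam_one_localAct]
    exact sum_norm_sq_unitary_conj V.2 _ (h _ _)
  · simp only [g, Fin.reduceFinMk, gam_two_localAct]
    exact sum_norm_sq_unitary_conj W.2 _ (h _ _)

theorem t_localAct_unitary (U V W : Matrix.unitaryGroup (Fin 2) ℂ) (ψ : Vec) :
    t (localAct U.val V.val W.val ψ) = t ψ := by
  simp only [t, T_localAct, norm_smul, norm_mul, norm_det_unitary, norm_localAct_unitary, one_mul]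

theorem tauSq_localAct_unitary (U V W : Matrix.unitaryGroup (Fin 2) ℂ) (ψ : Vec) :
    tauSq (localAct U.val V.val W.val ψ) = tauSq ψ := by
  simp only [tauSq, q_localAct, norm_pow, norm_mul, norm_det_unitary, one_mul, one_pow]

/-! ### Basic properties of the indicators -/

/-- An induction principle for the nine indicators: all of them are linear combinations of the
`g_a`, of `t` and of `τ²`. -/
theorem indicators_induction {P : (Vec → ℝ) → Prop} (hg : ∀ a, P (g a)) (ht : P t)
    (htau : P tauSq) (hadd : ∀ f f', P f → P f' → P fun ψ => f ψ + f' ψ)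
    (hmul : ∀ f, P f → P fun ψ => 2 / 3 * f ψ) : ∀ f ∈ indicators, P f := by
  rintro f (((rfl | rfl | rfl) | ⟨a, rfl⟩) | ⟨a, rfl⟩)
  · exact hmul _ (hadd _ _ (hadd _ _ (hg 0) (hg 1)) (hg 2))
  · exact ht
  · exact htau
  · exact hadd _ _ (hg _) (hg _)
  · exact hg a

theorem indicators_localAct_unitary :
    ∀ f ∈ indicators, ∀ U V W : Matrix.unitaryGroup (Fin 2) ℂ, ∀ ψ,
      f (localAct U.val V.val W.val ψ) = f ψ := by
  refine indicators_induction g_localAct_unitary t_localAct_unitary tauSq_localAct_unitary ?_ ?_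
  · intro f f' h h' U V W ψ
    simp only [h, h']
  · intro f h U V W ψ
    simp only [h]

theorem g_nonneg (a : Fin 3) (ψ : Vec) : 0 ≤ g a ψ := by
  unfold g; positivity

theorem t_nonneg (ψ : Vec) : 0 ≤ t ψ := by
  unfold t; positivity

theorem tauSq_nonneg (ψ : Vec) : 0 ≤ tauSq ψ := by
  unfold tauSq; positivity

theorem indicators_nonneg : ∀ f ∈ indicators, ∀ ψ, 0 ≤ f ψ :=
  indicators_induction g_nonneg t_nonneg tauSq_nonneg
    (fun _ _ h h' ψ => add_nonneg (h ψ) (h' ψ)) (fun _ h ψ => mul_nonneg (by norm_num) (h ψ))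

/-- `gam`, `T` and `q` are homogeneous of degrees 2, 3 and 4, so a phase disappears once norms are
taken. -/
theorem indicators_smul_of_norm_eq_one :
    ∀ f ∈ indicators, ∀ c : ℂ, ‖c‖ = 1 → ∀ ψ, f (c • ψ) = f ψ := by
  refine indicators_induction ?_ ?_ ?_ ?_ ?_
  · intro a c hc ψ
    simp [g, gam_smul, hc]
  · intro c hc ψ
    simp [t, T_smul, norm_smul, hc]
  · intro c hc ψ
    simp [tauSq, q_smul, hc]
  · intro f f' h h' c hc ψ
    simp only [h c hc, h' c hc]
  · intro f h c hc ψ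
    simp only [h c hc]

theorem continuous_gam_apply (a : Fin 3) (i j : Fin 2) : Continuous fun ψ => gam a ψ i j := by
  fin_cases a
  · simp only [Fin.zero_eta, gam_zero_apply]; fun_prop
  · simp only [Fin.mk_one, gam_one_apply]; fun_prop
  · simp only [Fin.reduceFinMk, gam_two_apply]; fun_prop

theorem indicators_continuous : ∀ f ∈ indicators, Continuous f := by
  refine indicators_induction ?_ ?_ ?_ ?_ ?_
  · intro a
    exact continuous_finsetSum _ fun i _ => continuous_finsetSum _ fun j _ =>
      (continuous_gam_apply a i j).norm.pow 2
  · have hT : Continuous T := by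
      refine (PiLp.continuous_toLp 2 _).comp (continuous_pi fun x => ?_)
      refine (continuous_finsetSum _ fun i _ => continuous_finsetSum _ fun j _ => ?_).neg
      exact (continuous_const.mul (continuous_gam_apply 0 _ _)).mul (by fun_prop)
    exact continuous_const.mul (hT.norm.pow 2)
  · have hq : Continuous q := by
      refine continuous_finsetSum _ fun i _ => continuous_finsetSum _ fun j _ =>
        continuous_finsetSum _ fun k _ => continuous_finsetSum _ fun l _ => ?_
      exact (continuous_const.mul (continuous_gam_apply 0 _ _)).mul (continuous_gam_apply 0 _ _)
    exact continuous_const.mul (hq.norm.pow 2)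
  · exact fun f f' h h' => h.add h'
  · exact fun f h => continuous_const.mul h

/-! ### Vectors with the same projector -/

theorem proj_apply (ψ : Vec) (x x' : Idx) : proj ψ x x' = ψ x * star (ψ x') := rfl

theorem exists_smul_eq_of_proj_eq {ψ φ : Vec} (h : proj ψ = proj φ) :
    ∃ c : ℂ, ‖c‖ = 1 ∧ ψ = c • φ := by
  have hx : ∀ x x', ψ x * star (ψ x') = φ x * star (φ x') := fun x x' => by
    rw [← proj_apply, ← proj_apply, h]
  have hn : ∀ x, ‖ψ x‖ = ‖φ x‖ := fun x => by
    have := congrArg norm (hx x x)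
    simp only [norm_mul, norm_star] at this
    exact (mul_self_inj (norm_nonneg _) (norm_nonneg _)).1 this
  by_cases h0 : ψ = 0
  · refine ⟨1, norm_one, ?_⟩
    ext x
    have := hn x
    rw [h0] at this ⊢
    simp only [PiLp.zero_apply, norm_zero] at this
    simp [norm_eq_zero.1 this.symm]
  · obtain ⟨x₀, hx₀⟩ : ∃ x, ψ x ≠ 0 := by
      by_contra! hc
      exact h0 (by ext x; simpa using hc x)
    have hs : star (ψ x₀) ≠ 0 := star_ne_zero.2 hx₀
    -- The phase comes from solving `ψ x * star (ψ x₀) = φ x * star (φ x₀)` for `ψ x`.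
    refine ⟨star (φ x₀) / star (ψ x₀), ?_, ?_⟩
    · rw [norm_div, norm_star, norm_star, ← hn, div_self (norm_ne_zero_iff.2 hx₀)]
    · ext x
      simp only [PiLp.smul_apply, smul_eq_mul]
      rw [div_mul_eq_mul_div, eq_div_iff hs, hx x x₀, mul_comm]

theorem indicators_eq_of_proj_eq :
    ∀ f ∈ indicators, ∀ ψ φ, proj ψ = proj φ → f ψ = f φ := by
  intro f hf ψ φ h
  obtain ⟨c, hc, rfl⟩ := exists_smul_eq_of_proj_eq h
  exact indicators_smul_of_norm_eq_one f hf c hc φ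

/-! ### Canonical vectors of the SLOCC classes -/

theorem exists_mulVec_eq {u : Fin 2 → ℂ} (hu : u ≠ 0) :
    ∃ A : Matrix (Fin 2) (Fin 2) ℂ, A.det ≠ 0 ∧ A *ᵥ ![1, 0] = u := by
  by_cases h0 : u 0 = 0
  · have h1 : u 1 ≠ 0 := fun h1 => hu (by ext i; fin_cases i <;> simp [h0, h1])
    refine ⟨!![0, 1; u 1, 0], by simp [Matrix.det_fin_two, h1], ?_⟩
    ext i; fin_cases i <;> simp [Matrix.mulVec, h0]
  · refine ⟨!![u 0, 0; u 1, 1], by simp [Matrix.det_fin_two, h0], ?_⟩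
    ext i; fin_cases i <;> simp [Matrix.mulVec]

theorem exists_mulVec_eq_single {u : Fin 2 → ℂ} (hu : u ≠ 0) :
    ∃ A : Matrix (Fin 2) (Fin 2) ℂ, A.det ≠ 0 ∧ A *ᵥ u = ![1, 0] := by
  obtain ⟨A, hA, rfl⟩ := exists_mulVec_eq hu
  have hA' : IsUnit A.det := isUnit_iff_ne_zero.2 hA
  refine ⟨A⁻¹, ?_, ?_⟩
  · exact (Matrix.isUnit_nonsing_inv_det A hA').ne_zero
  · rw [Matrix.mulVec_mulVec, Matrix.nonsing_inv_mul A hA', Matrix.one_mulVec]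

theorem isProduct2_iff (v : Fin 2 → Fin 2 → ℂ) : IsProduct2 v ↔ v 0 0 * v 1 1 = v 0 1 * v 1 0 := by
  constructor
  · rintro ⟨s, t, h⟩
    simp only [h]; ring
  · intro h
    by_cases hv : ∃ a b, v a b ≠ 0
    · obtain ⟨a, b, hab⟩ := hv
      -- A matrix of rank one is the product of the column and the row through a nonzero entry,
      -- divided by that entry.
      refine ⟨fun i => v i b, fun j => v a j / v a b, fun i j => ?_⟩
      rw [mul_div_assoc', eq_div_iff hab]
      revert h
      fin_cases a <;> fin_cases b <;> fin_cases i <;> fin_cases j <;> simp <;> grind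
    · push Not at hv
      exact ⟨0, 0, fun i j => by simp [hv]⟩

theorem localAct_tensor3 (A B C : Matrix (Fin 2) (Fin 2) ℂ) (u v w : Fin 2 → ℂ) :
    localAct A B C (tensor3 u v w) = tensor3 (A *ᵥ u) (B *ᵥ v) (C *ᵥ w) := by
  ext ⟨i, j, k⟩
  rw [localAct_apply]
  simp [tensor3, Matrix.mulVec, dotProduct]
  ring

theorem localAct_tensor12_zero (A B C : Matrix (Fin 2) (Fin 2) ℂ) (u : Fin 2 → ℂ)
    (v : Fin 2 → Fin 2 → ℂ) :
    localAct A B C (tensor12 0 u v) = tensor12 0 (A *ᵥ u) (Matrix.of.symm (B * Matrix.of v * Cᵀ)) := by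
  ext ⟨i, j, k⟩
  rw [localAct_apply]
  simp [tensor12, Matrix.mulVec, dotProduct, Matrix.mul_apply]
  ring

theorem localAct_tensor12_one (A B C : Matrix (Fin 2) (Fin 2) ℂ) (u : Fin 2 → ℂ)
    (v : Fin 2 → Fin 2 → ℂ) :
    localAct A B C (tensor12 1 u v) = tensor12 1 (B *ᵥ u) (Matrix.of.symm (A * Matrix.of v * Cᵀ)) := by
  ext ⟨i, j, k⟩
  rw [localAct_apply]
  simp [tensor12, Matrix.mulVec, dotProduct, Matrix.mul_apply]
  ring

theorem localAct_tensor12_two (A B C : Matrix (Fin 2) (Fin 2) ℂ) (u : Fin 2 → ℂ)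
    (v : Fin 2 → Fin 2 → ℂ) :
    localAct A B C (tensor12 2 u v) = tensor12 2 (C *ᵥ u) (Matrix.of.symm (A * Matrix.of v * Bᵀ)) := by
  ext ⟨i, j, k⟩
  rw [localAct_apply]
  simp [tensor12, Matrix.mulVec, dotProduct, Matrix.mul_apply]
  ring

/-- A canonical vector in each SLOCC class. -/
def canonical : SLOCCLabel → Vec
  | .null => 0
  | .sep => tensor3 ![1, 0] ![1, 0] ![1, 0]
  | .bisep a => tensor12 a ![1, 0] ![![1, 0], ![0, 1]]
  | .W => stateW
  | .GHZ => stateGHZ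

theorem det_ne_zero_iff_not_isProduct2 (v : Fin 2 → Fin 2 → ℂ) :
    (Matrix.of v).det ≠ 0 ↔ ¬ IsProduct2 v := by
  rw [isProduct2_iff, Matrix.det_fin_two, ne_eq, sub_eq_zero]
  rfl

theorem mulVec_ne_zero_of_det_ne_zero {A : Matrix (Fin 2) (Fin 2) ℂ} (hA : A.det ≠ 0) :
    A *ᵥ ![1, 0] ≠ 0 := fun h =>
  hA (Matrix.exists_mulVec_eq_zero_iff.1 ⟨![1, 0], by simp, h⟩)

theorem tensor3_ne_zero {u v w : Fin 2 → ℂ} (hu : u ≠ 0) (hv : v ≠ 0) (hw : w ≠ 0) :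
    tensor3 u v w ≠ 0 := by
  obtain ⟨i, hi⟩ := Function.ne_iff.1 hu
  obtain ⟨j, hj⟩ := Function.ne_iff.1 hv
  obtain ⟨k, hk⟩ := Function.ne_iff.1 hw
  intro h
  have : tensor3 u v w (i, j, k) = 0 := by rw [h]; rfl
  simp only [tensor3] at this
  exact mul_ne_zero (mul_ne_zero hi hj) hk this

theorem det_val_ne_zero (A : GL (Fin 2) ℂ) : A.val.det ≠ 0 :=
  (Matrix.isUnits_det_units A).ne_zero

theorem of_identity : (Matrix.of ![![1, 0], ![0, 1]] : Matrix (Fin 2) (Fin 2) ℂ) = 1 :=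
  Matrix.one_fin_two.symm

/-- Seen as a 2×2 matrix, the two-qubit factor is not a product exactly when it is invertible, and
the canonical one is the identity. The matrix of `v` can then itself serve as the local operator on
one of the two qubits. -/
theorem mem_sloccClass_bisep_iff (a : Fin 3) (ψ : Vec) :
    ψ ∈ sloccClass (.bisep a) ↔ SLOCCEquiv (canonical (.bisep a)) ψ := by
  constructor
  · rintro ⟨u, v, hu, hv, rfl⟩
    obtain ⟨A, hA, rfl⟩ := exists_mulVec_eq hu
    have hv' := (det_ne_zero_iff_not_isProduct2 v).2 hv
    have h1 : (1 : Matrix (Fin 2) (Fin 2) ℂ).det ≠ 0 := by simp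
    fin_cases a
    · have := SLOCCEquiv.of_det_ne_zero hA hv' h1 (canonical (.bisep 0))
      rw [canonical, localAct_tensor12_zero] at this
      simpa [canonical, of_identity] using this
    · have := SLOCCEquiv.of_det_ne_zero hv' hA h1 (canonical (.bisep 1))
      rw [canonical, localAct_tensor12_one] at this
      simpa [canonical, of_identity] using this
    · have := SLOCCEquiv.of_det_ne_zero hv' h1 hA (canonical (.bisep 2))
      rw [canonical, localAct_tensor12_two] at this
      simpa [canonical, of_identity] using this
  · rintro ⟨A, B, C, rfl⟩
    have hA := det_val_ne_zero A
    have hB := det_val_ne_zero B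
    have hC := det_val_ne_zero C
    have key : ∀ {M N : Matrix (Fin 2) (Fin 2) ℂ}, M.det ≠ 0 → N.det ≠ 0 →
        ¬ IsProduct2 (Matrix.of.symm (M * Matrix.of ![![1, 0], ![0, 1]] * Nᵀ)) := fun hM hN => by
      rw [← det_ne_zero_iff_not_isProduct2]
      simpa [of_identity] using ⟨hM, hN⟩
    fin_cases a
    · exact ⟨_, _, mulVec_ne_zero_of_det_ne_zero hA, key hB hC, localAct_tensor12_zero _ _ _ _ _⟩
    · exact ⟨_, _, mulVec_ne_zero_of_det_ne_zero hB, key hA hC, localAct_tensor12_one _ _ _ _ _⟩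
    · exact ⟨_, _, mulVec_ne_zero_of_det_ne_zero hC, key hA hB, localAct_tensor12_two _ _ _ _ _⟩

theorem mem_sloccClass_iff (l : SLOCCLabel) (ψ : Vec) :
    ψ ∈ sloccClass l ↔ SLOCCEquiv (canonical l) ψ := by
  cases l with
  | null =>
    constructor
    · rintro rfl
      exact SLOCCEquiv.refl 0
    · rintro ⟨A, B, C, rfl⟩
      exact localAct_zero _ _ _
  | sep =>
    constructor
    · rintro ⟨h0, u, v, w, rfl⟩
      have hu : u ≠ 0 := by rintro rfl; exact h0 (by ext; simp [tensor3])
      have hv : v ≠ 0 := by rintro rfl; exact h0 (by ext; simp [tensor3])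
      have hw : w ≠ 0 := by rintro rfl; exact h0 (by ext; simp [tensor3])
      obtain ⟨A, hA, rfl⟩ := exists_mulVec_eq hu
      obtain ⟨B, hB, rfl⟩ := exists_mulVec_eq hv
      obtain ⟨C, hC, rfl⟩ := exists_mulVec_eq hw
      rw [← localAct_tensor3]
      exact SLOCCEquiv.of_det_ne_zero hA hB hC _
    · rintro ⟨A, B, C, rfl⟩
      rw [canonical, localAct_tensor3]
      refine ⟨tensor3_ne_zero ?_ ?_ ?_, _, _, _, rfl⟩ <;>
        exact mulVec_ne_zero_of_det_ne_zero (det_val_ne_zero _)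
  | bisep a => exact mem_sloccClass_bisep_iff a ψ
  | W => rfl
  | GHZ => rfl

/-! ### Every vector belongs to an SLOCC class -/

/-- Since the classes are orbits, a vector may be normalized by invertible local operators before it
is classified. -/
theorem exists_mem_sloccClass_of_localAct {A B C : Matrix (Fin 2) (Fin 2) ℂ} (hA : A.det ≠ 0)
    (hB : B.det ≠ 0) (hC : C.det ≠ 0) {ψ : Vec} (h : ∃ l, localAct A B C ψ ∈ sloccClass l) :
    ∃ l, ψ ∈ sloccClass l := by
  obtain ⟨l, hl⟩ := h
  rw [mem_sloccClass_iff] at hl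
  exact ⟨l, (mem_sloccClass_iff l ψ).2 (hl.trans (SLOCCEquiv.of_det_ne_zero hA hB hC ψ).symm)⟩

/-- Vectors of the form `|000⟩ + |1⟩ ⊗ v`. -/
theorem exists_mem_sloccClass_of_slice {ψ : Vec}
    (h0 : ∀ j k, ψ (0, j, k) = (![1, 0] : Fin 2 → ℂ) j * (![1, 0] : Fin 2 → ℂ) k) :
    ∃ l, ψ ∈ sloccClass l := by
  obtain ⟨h00, h01, h10, h11⟩ : ψ (0, 0, 0) = 1 ∧ ψ (0, 0, 1) = 0 ∧ ψ (0, 1, 0) = 0 ∧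
      ψ (0, 1, 1) = 0 := by simp [h0]
  obtain ⟨a, ha⟩ : ∃ a, ψ (1, 0, 0) = a := ⟨_, rfl⟩
  obtain ⟨b, hb⟩ : ∃ b, ψ (1, 0, 1) = b := ⟨_, rfl⟩
  obtain ⟨c, hc⟩ : ∃ c, ψ (1, 1, 0) = c := ⟨_, rfl⟩
  obtain ⟨d, hd⟩ : ∃ d, ψ (1, 1, 1) = d := ⟨_, rfl⟩
  have hs2 : ((Real.sqrt 2 : ℝ) : ℂ) ≠ 0 := by simp
  have hs3 : ((Real.sqrt 3 : ℝ) : ℂ) ≠ 0 := by simp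
  by_cases hd0 : d = 0
  · subst hd0
    by_cases hb0 : b = 0
    · subst hb0
      by_cases hc0 : c = 0
      · subst hc0
        refine ⟨.sep, ?_, ![1, a], ![1, 0], ![1, 0], ?_⟩
        · rintro rfl
          simp at h00
        · ext ⟨i, j, k⟩
          fin_cases i <;> fin_cases j <;> fin_cases k <;>
            simp [tensor3, h00, h01, h10, h11, ha, hb, hc, hd]
      · refine ⟨.bisep 2, ![1, 0], ![![1, 0], ![a, c]], by simp, ?_, ?_⟩
        · simp [isProduct2_iff, hc0]
        · ext ⟨i, j, k⟩
          fin_cases i <;> fin_cases j <;> fin_cases k <;>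
            simp [tensor12, h00, h01, h10, h11, ha, hb, hc, hd]
    · by_cases hc0 : c = 0
      · subst hc0
        refine ⟨.bisep 1, ![1, 0], ![![1, 0], ![a, b]], by simp, ?_, ?_⟩
        · simp [isProduct2_iff, hb0]
        · ext ⟨i, j, k⟩
          fin_cases i <;> fin_cases j <;> fin_cases k <;>
            simp [tensor12, h00, h01, h10, h11, ha, hb, hc, hd]
      · refine ⟨.W, ?_⟩
        -- Here `ψ = (|0⟩ + a|1⟩)|00⟩ + c|110⟩ + b|101⟩`. The first operator exchanges `|0⟩` and
        -- `|1⟩` up to the shear by `a`, and `√3` cancels the normalization of `stateW`.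
        have key : ψ = localAct !![0, (Real.sqrt 3 : ℝ); (Real.sqrt 3 : ℝ), (Real.sqrt 3 : ℝ) * a]
            !![1, 0; 0, c] !![1, 0; 0, b] stateW := by
          ext ⟨i, j, k⟩
          rw [localAct_apply]
          fin_cases i <;> fin_cases j <;> fin_cases k <;>
            simp [stateW, h00, h01, h10, h11, ha, hb, hc, hd] <;> field_simp
        rw [key]
        refine SLOCCEquiv.of_det_ne_zero ?_ ?_ ?_ _ <;> simp [Matrix.det_fin_two, hb0, hc0]
  · refine ⟨.GHZ, ?_⟩
    -- Completing the product in the second slice gives `v = (a - bc/d)|00⟩ + d (b/d |0⟩ + |1⟩) ⊗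
    -- (c/d |0⟩ + |1⟩)`. So `ψ` is a sum of two product vectors, linearly independent on every
    -- qubit; `√2` cancels the normalization of `stateGHZ`.
    have key : ψ = localAct
        !![(Real.sqrt 2 : ℝ), 0; (Real.sqrt 2 : ℝ) * (a - b * c / d), (Real.sqrt 2 : ℝ) * d]
        !![1, b / d; 0, 1] !![1, c / d; 0, 1] stateGHZ := by
      ext ⟨i, j, k⟩
      rw [localAct_apply]
      fin_cases i <;> fin_cases j <;> fin_cases k <;>
        simp [stateGHZ, h00, h01, h10, h11, ha, hb, hc, hd] <;> field_simp <;> ring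
    rw [key]
    refine SLOCCEquiv.of_det_ne_zero ?_ ?_ ?_ _ <;> simp [Matrix.det_fin_two, hd0]

/-- A nonzero product slice can be rotated to `|00⟩` by operators on the last two qubits. If the
slice is zero, then `ψ = |1⟩ ⊗ v`, and only the rank of `v` matters. -/
theorem exists_mem_sloccClass_of_isProduct2 {ψ : Vec} (h : IsProduct2 fun j k => ψ (0, j, k)) :
    ∃ l, ψ ∈ sloccClass l := by
  by_cases h0 : ∀ j k, ψ (0, j, k) = 0
  · have hψ : ψ = tensor12 0 ![0, 1] fun j k => ψ (1, j, k) := by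
      ext ⟨i, j, k⟩
      fin_cases i <;> simp [tensor12, h0]
    by_cases h1 : IsProduct2 fun j k => ψ (1, j, k)
    · by_cases hz : ψ = 0
      · exact ⟨.null, hz⟩
      · obtain ⟨s, t, hst⟩ := h1
        refine ⟨.sep, hz, ![0, 1], s, t, ?_⟩
        ext ⟨i, j, k⟩
        fin_cases i <;> simp [tensor3, h0, hst]
    · exact ⟨.bisep 0, _, _, by simp, h1, hψ⟩
  · obtain ⟨s, t, hst⟩ := h
    have hs : s ≠ 0 := by rintro rfl; exact h0 fun j k => by simp [hst]
    have ht : t ≠ 0 := by rintro rfl; exact h0 fun j k => by simp [hst]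
    obtain ⟨B, hB, hBs⟩ := exists_mulVec_eq_single hs
    obtain ⟨C, hC, hCt⟩ := exists_mulVec_eq_single ht
    refine exists_mem_sloccClass_of_localAct (A := 1) (by simp) hB hC
      (exists_mem_sloccClass_of_slice fun j k => ?_)
    have hC' := congrFun hCt k
    rw [← hC', ← hBs, localAct_apply]
    simp only [Fin.sum_univ_two, Matrix.mulVec, dotProduct, hst, Matrix.one_apply_eq, ne_eq,
      zero_ne_one, not_false_eq_true, Matrix.one_apply_ne]
    ring

theorem exists_mem_sloccClass (ψ : Vec) : ∃ l, ψ ∈ sloccClass l := by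
  by_cases h : ψ (1, 0, 0) * ψ (1, 1, 1) = ψ (1, 0, 1) * ψ (1, 1, 0)
  · refine exists_mem_sloccClass_of_localAct (A := !![0, 1; 1, 0]) (B := 1) (C := 1)
      (by simp [Matrix.det_fin_two]) (by simp) (by simp)
      (exists_mem_sloccClass_of_isProduct2 ((isProduct2_iff _).2 ?_))
    simpa [localAct_fst_apply] using h
  -- The determinant of the first slice plus `x` times the second is a quadratic in `x` with leading
  -- coefficient the determinant of the second, nonzero here. A complex root `x` defines the shear
  -- that makes the first slice singular.
  · obtain ⟨s, hs⟩ := IsAlgClosed.exists_eq_mul_self (discrim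
      (ψ (1, 0, 0) * ψ (1, 1, 1) - ψ (1, 0, 1) * ψ (1, 1, 0))
      (ψ (0, 0, 0) * ψ (1, 1, 1) + ψ (1, 0, 0) * ψ (0, 1, 1)
        - ψ (0, 0, 1) * ψ (1, 1, 0) - ψ (1, 0, 1) * ψ (0, 1, 0))
      (ψ (0, 0, 0) * ψ (0, 1, 1) - ψ (0, 0, 1) * ψ (0, 1, 0)))
    obtain ⟨x, hx⟩ := exists_quadratic_eq_zero (sub_ne_zero.2 h) ⟨s, hs⟩
    refine exists_mem_sloccClass_of_localAct (A := !![1, x; 0, 1]) (B := 1) (C := 1)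
      (by simp [Matrix.det_fin_two]) (by simp) (by simp)
      (exists_mem_sloccClass_of_isProduct2 ((isProduct2_iff _).2 ?_))
    simp [localAct_fst_apply]
    linear_combination hx

/-! ### The vanishing pattern of the covariants on the SLOCC classes -/

/-- Whether the covariant `γ_a` vanishes on an SLOCC class. -/
def GamVanishes : SLOCCLabel → Fin 3 → Prop
  | .null, _ => True
  | .sep, _ => True
  | .bisep b, a => a ≠ b
  | .W, _ => False
  | .GHZ, _ => False

/-- The covariants of `ψ` vanish exactly as they do on the SLOCC class `l`. -/
structure HasProfile (l : SLOCCLabel) (ψ : Vec) : Prop where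
  eq_zero_iff : ψ = 0 ↔ l = .null
  gam_eq_zero_iff : ∀ a, gam a ψ = 0 ↔ GamVanishes l a
  T_eq_zero_iff : T ψ = 0 ↔ l ≠ .W ∧ l ≠ .GHZ
  q_eq_zero_iff : q ψ = 0 ↔ l ≠ .GHZ

/-- The conditions on `ψ`, `gam` and `q` already separate all labels: `bisep a` is recognized by
`gam a` being the only surviving covariant `gam`, and W and GHZ differ in `q`. -/
theorem HasProfile.unique {l l' : SLOCCLabel} {ψ : Vec} (h : HasProfile l ψ)
    (h' : HasProfile l' ψ) : l = l' := by
  have h1 := h.eq_zero_iff.symm.trans h'.eq_zero_iff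
  have h2 := fun a => (h.gam_eq_zero_iff a).symm.trans (h'.gam_eq_zero_iff a)
  have h4 := h.q_eq_zero_iff.symm.trans h'.q_eq_zero_iff
  rcases l with _ | _ | a | _ | _ <;> rcases l' with _ | _ | b | _ | _ <;>
    simp [GamVanishes] at h1 h2 h4 ⊢
  · by_contra hab
    exact absurd rfl ((h2 b).1 (Ne.symm hab))
  · exact absurd ((h2 (a + 1))) (by simp)
  · exact absurd ((h2 (b + 1))) (by simp)

theorem localAct_eq_zero_iff (A B C : GL (Fin 2) ℂ) (ψ : Vec) :
    localAct A.val B.val C.val ψ = 0 ↔ ψ = 0 := by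
  constructor
  · intro h
    have := congrArg (localAct A⁻¹.val B⁻¹.val C⁻¹.val) h
    rw [← localAct_mul, localAct_zero] at this
    simpa only [← Units.val_mul, inv_mul_cancel, Units.val_one, localAct_one] using this
  · rintro rfl
    exact localAct_zero _ _ _

theorem conj_transpose_eq_zero_iff (A : GL (Fin 2) ℂ) (M : Matrix (Fin 2) (Fin 2) ℂ) :
    A.val * M * A.valᵀ = 0 ↔ M = 0 := by
  have hA : IsUnit A.val := A.isUnit
  have hA' : IsUnit A.valᵀ := (Matrix.isUnit_transpose _).2 hA
  rw [hA'.mul_left_eq_zero, hA.mul_right_eq_zero]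

/-- By covariance, invertible operators multiply each covariant by invertible factors only, so one
evaluation per class suffices. -/
theorem HasProfile.localAct {l : SLOCCLabel} {ψ : Vec} (h : HasProfile l ψ)
    (A B C : GL (Fin 2) ℂ) : HasProfile l (localAct A.val B.val C.val ψ) where
  eq_zero_iff := (localAct_eq_zero_iff A B C ψ).trans h.eq_zero_iff
  gam_eq_zero_iff a := by
    rw [← h.gam_eq_zero_iff]
    have hA := det_val_ne_zero A
    have hB := det_val_ne_zero B
    have hC := det_val_ne_zero C
    fin_cases a
    · simp only [Fin.zero_eta, gam_zero_localAct, smul_eq_zero, mul_eq_zero, hB, hC, false_or,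
        conj_transpose_eq_zero_iff]
    · simp only [Fin.mk_one, gam_one_localAct, smul_eq_zero, mul_eq_zero, hA, hC, false_or,
        conj_transpose_eq_zero_iff]
    · simp only [Fin.reduceFinMk, gam_two_localAct, smul_eq_zero, mul_eq_zero, hA, hB, false_or,
        conj_transpose_eq_zero_iff]
  T_eq_zero_iff := by
    rw [← h.T_eq_zero_iff, T_localAct]
    simp only [smul_eq_zero, mul_eq_zero, det_val_ne_zero, false_or, localAct_eq_zero_iff]
  q_eq_zero_iff := by
    rw [← h.q_eq_zero_iff, q_localAct]
    simp [det_val_ne_zero]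

theorem hasProfile_canonical (l : SLOCCLabel) : HasProfile l (canonical l) := by
  have e0 : ∀ ψ : Vec, ψ = 0 ↔ ∀ i j k, ψ (i, j, k) = 0 := fun ψ =>
    ⟨by rintro rfl; simp, fun h => by ext ⟨i, j, k⟩; exact h i j k⟩
  rcases l with _ | _ | a | _ | _
  all_goals try fin_cases a
  all_goals
    constructor
    · simp [e0, Fin.forall_fin_two, canonical, tensor3, tensor12, stateW, stateGHZ]
    · simp [Fin.forall_fin_succ, ← Matrix.ext_iff, canonical, gam_zero_apply, gam_one_apply,
        gam_two_apply, tensor3, tensor12, stateW, stateGHZ, GamVanishes, neg_sub_left]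
    · simp [e0, Fin.forall_fin_two, canonical, T_apply, gam_zero_apply, tensor3, tensor12, stateW,
        stateGHZ, neg_sub_left]
    · simp [canonical, q_eq, gam_zero_apply, tensor3, tensor12, stateW, stateGHZ, neg_sub_left]

theorem hasProfile_of_mem_sloccClass {l : SLOCCLabel} {ψ : Vec} (h : ψ ∈ sloccClass l) :
    HasProfile l ψ := by
  obtain ⟨A, B, C, rfl⟩ := (mem_sloccClass_iff l ψ).1 h
  exact (hasProfile_canonical l).localAct A B C

/-- The converse combines exhaustiveness with uniqueness: `ψ` lies in some class, and its profile
leaves no choice of which. -/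
theorem mem_sloccClass_iff_hasProfile (l : SLOCCLabel) (ψ : Vec) :
    ψ ∈ sloccClass l ↔ HasProfile l ψ := by
  refine ⟨hasProfile_of_mem_sloccClass, fun h => ?_⟩
  obtain ⟨l', hl'⟩ := exists_mem_sloccClass ψ
  rwa [h.unique (hasProfile_of_mem_sloccClass hl')]

theorem existsUnique_mem_sloccClass (ψ : Vec) : ∃! l, ψ ∈ sloccClass l := by
  obtain ⟨l, hl⟩ := exists_mem_sloccClass ψ
  exact ⟨l, hl, fun l' hl' =>
    (hasProfile_of_mem_sloccClass hl').unique (hasProfile_of_mem_sloccClass hl)⟩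

theorem mem_sloccClass_iff_sloccEquiv {l : SLOCCLabel} {ψ : Vec} (h : ψ ∈ sloccClass l)
    (φ : Vec) : φ ∈ sloccClass l ↔ SLOCCEquiv ψ φ := by
  rw [mem_sloccClass_iff] at h ⊢
  exact ⟨h.symm.trans, h.trans⟩

/-! ### The indicators on the SLOCC classes -/

theorem g_eq_zero_iff (a : Fin 3) (ψ : Vec) : g a ψ = 0 ↔ gam a ψ = 0 := by
  unfold g
  rw [Finset.sum_eq_zero_iff_of_nonneg fun i _ => by positivity, ← Matrix.ext_iff]
  refine forall_congr' fun i => ?_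
  simp only [Finset.mem_univ, true_imp_iff]
  rw [Finset.sum_eq_zero_iff_of_nonneg fun j _ => by positivity]
  simp

theorem t_eq_zero_iff (ψ : Vec) : t ψ = 0 ↔ T ψ = 0 := by simp [t]

theorem tauSq_eq_zero_iff (ψ : Vec) : tauSq ψ = 0 ↔ q ψ = 0 := by simp [tauSq]

theorem n_eq_zero_iff (ψ : Vec) : n ψ = 0 ↔ ψ = 0 := by simp [n]

theorem csq_eq_zero_iff (a : Fin 3) (ψ : Vec) :
    csq a ψ = 0 ↔ gam (a + 1) ψ = 0 ∧ gam (a + 2) ψ = 0 := by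
  rw [csq, add_eq_zero_iff_of_nonneg (g_nonneg _ _) (g_nonneg _ _), g_eq_zero_iff, g_eq_zero_iff]

theorem y_eq_zero_iff (ψ : Vec) : y ψ = 0 ↔ ∀ a, gam a ψ = 0 := by
  simp only [y, mul_eq_zero, OfNat.ofNat_ne_zero, div_eq_zero_iff, false_or,
    add_eq_zero_iff_of_nonneg (add_nonneg (g_nonneg 0 ψ) (g_nonneg 1 ψ)) (g_nonneg 2 ψ),
    add_eq_zero_iff_of_nonneg (g_nonneg 0 ψ) (g_nonneg 1 ψ), g_eq_zero_iff,
    Fin.forall_fin_succ, IsEmpty.forall_iff, and_true, and_assoc]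
  rfl

/-! ### Compactness of convex hulls -/

/-- In finite dimension, the convex hull of a compact set is compact. -/
theorem isCompact_convexHull {E : Type*} [AddCommGroup E] [Module ℝ E] [TopologicalSpace E]
    [IsTopologicalAddGroup E] [ContinuousSMul ℝ E] [FiniteDimensional ℝ E] {s : Set E}
    (hs : IsCompact s) : IsCompact (convexHull ℝ s) := by
  -- By Carathéodory, at most `finrank + 1` points are needed, so the hull is a finite union of
  -- continuous images of compact sets.
  have h : convexHull ℝ s = ⋃ m ∈ Finset.range (Module.finrank ℝ E + 2),
      (fun x : (Fin m → ℝ) × (Fin m → E) => ∑ i, x.1 i • x.2 i) ''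
        (stdSimplex ℝ (Fin m) ×ˢ Set.univ.pi fun _ => s) := by
    ext x
    simp only [Set.mem_iUnion, Finset.mem_range, Set.mem_image, Set.mem_prod, Set.mem_univ_pi,
      Prod.exists, exists_prop]
    constructor
    · intro hx
      obtain ⟨ι, _, z, w, hz, hind, hw, hw1, rfl⟩ := eq_pos_convex_span_of_mem_convexHull hx
      have hcard : Fintype.card ι < Module.finrank ℝ E + 2 := by
        have h1 := hind.card_le_finrank_succ
        have h2 := Submodule.finrank_le (vectorSpan ℝ (Set.range z))
        omega
      let e := (Fintype.equivFin ι).symm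
      refine ⟨_, hcard, w ∘ e, z ∘ e, ⟨⟨fun i => (hw _).le, ?_⟩, fun i => hz ⟨_, rfl⟩⟩, ?_⟩
      · exact (e.sum_comp w).trans hw1
      · exact e.sum_comp fun i => w i • z i
    · rintro ⟨m, -, w, z, ⟨⟨hw, hw1⟩, hz⟩, rfl⟩
      exact mem_convexHull_of_exists_fintype w z hw hw1 hz rfl
  rw [h]
  refine (Finset.range _).isCompact_biUnion fun m _ => ?_
  exact ((isCompact_stdSimplex ℝ (Fin m)).prod (isCompact_univ_pi fun _ => hs)).image
    (by fun_prop)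

/-! ### Decompositions of mixed states -/

theorem continuous_proj : Continuous proj := by
  refine continuous_matrix fun x x' => ?_
  simp only [proj_apply]
  fun_prop

/-- The spectral decomposition: eigenvalues are the weights, and an orthonormal eigenbasis supplies
the unit vectors. -/
theorem exists_eq_sum_proj {ρ : Matrix Idx Idx ℂ} (hρ : ρ ∈ states) :
    ∃ (p : Idx → ℝ) (ψ : Idx → Vec), (∀ i, 0 ≤ p i) ∧ ∑ i, p i = 1 ∧ (∀ i, ‖ψ i‖ = 1) ∧
      ρ = ∑ i, p i • proj (ψ i) := by
  obtain ⟨hpos, htr⟩ := hρ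
  have hh := hpos.isHermitian
  refine ⟨hh.eigenvalues, hh.eigenvectorBasis, hpos.eigenvalues_nonneg, ?_,
    hh.eigenvectorBasis.orthonormal.1, ?_⟩
  · have h := hh.trace_eq_sum_eigenvalues
    rw [htr] at h
    apply Complex.ofReal_injective
    rw [Complex.ofReal_sum, Complex.ofReal_one]
    exact h.symm
  · conv_lhs => rw [hh.spectral_theorem]
    ext x x'
    rw [Unitary.conjStarAlgAut_apply, Matrix.mul_apply, Matrix.sum_apply]
    refine Finset.sum_congr rfl fun i _ => ?_
    rw [Matrix.mul_diagonal, Matrix.smul_apply, proj_apply, Matrix.star_apply,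
      Matrix.IsHermitian.eigenvectorUnitary_apply, Matrix.IsHermitian.eigenvectorUnitary_apply,
      Complex.real_smul]
    simp only [Function.comp_apply, Complex.coe_algebraMap]
    ring

/-- The values of the averages over decompositions form a slice of a convex hull. -/
theorem mem_roofValues_iff {f : Vec → ℝ} {ρ : Matrix Idx Idx ℂ} {r : ℝ} :
    r ∈ roofValues f ρ ↔
      (ρ, r) ∈ convexHull ℝ ((fun ψ => (proj ψ, f ψ)) '' Metric.sphere (0 : Vec) 1) := by
  constructor
  · rintro ⟨m, p, ψ, hp, hp1, hψ, rfl, rfl⟩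
    refine mem_convexHull_of_exists_fintype p (fun i => (proj (ψ i), f (ψ i))) hp hp1
      (fun i => ⟨ψ i, by simpa using hψ i, rfl⟩) ?_
    ext1
    · simp [Prod.fst_sum]
    · simp [Prod.snd_sum]
  · intro h
    obtain ⟨ι, _, w, z, hw, hw1, hz, hsum⟩ := mem_convexHull_iff_exists_fintype.1 h
    choose ψ hψ hz using hz
    obtain ⟨rfl⟩ : z = fun i => (proj (ψ i), f (ψ i)) := funext fun i => (hz i).symm
    let e := (Fintype.equivFin ι).symm
    refine ⟨_, w ∘ e, ψ ∘ e, fun i => hw _, (e.sum_comp w).trans hw1,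
      fun i => by simpa using hψ (e i), ?_, ?_⟩
    · have := congrArg Prod.fst hsum
      rw [Prod.fst_sum] at this
      exact (this.symm).trans (e.sum_comp fun i => w i • proj (ψ i)).symm
    · have := congrArg Prod.snd hsum
      rw [Prod.snd_sum] at this
      exact (this.symm).trans (e.sum_comp fun i => w i * f (ψ i)).symm

theorem roofValues_nonempty (f : Vec → ℝ) {ρ : Matrix Idx Idx ℂ} (hρ : ρ ∈ states) :
    (roofValues f ρ).Nonempty := by
  obtain ⟨p, ψ, hp, hp1, hψ, h⟩ := exists_eq_sum_proj hρ
  refine ⟨∑ i, p i * f (ψ i), mem_roofValues_iff.2 ?_⟩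
  refine mem_convexHull_of_exists_fintype p (fun i => (proj (ψ i), f (ψ i))) hp hp1
    (fun i => ⟨ψ i, by simpa using hψ i, rfl⟩) ?_
  ext1
  · simp [Prod.fst_sum, h]
  · simp [Prod.snd_sum]

/-- The attained averages are the fibre over `ρ` of a compact convex hull, hence a nonempty compact
set of reals. -/
theorem isLeast_roof {f : Vec → ℝ} (hf : Continuous f) {ρ : Matrix Idx Idx ℂ}
    (hρ : ρ ∈ states) : IsLeast (roofValues f ρ) (roof f ρ) := by
  have hc : IsCompact (convexHull ℝ
      ((fun ψ => (proj ψ, f ψ)) '' Metric.sphere (0 : Vec) 1)) :=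
    isCompact_convexHull ((isCompact_sphere _ _).image (continuous_proj.prodMk hf))
  have himg : roofValues f ρ = Prod.snd '' (convexHull ℝ
      ((fun ψ => (proj ψ, f ψ)) '' Metric.sphere (0 : Vec) 1) ∩ Prod.fst ⁻¹' {ρ}) := by
    ext r
    rw [mem_roofValues_iff]
    constructor
    · exact fun h => ⟨(ρ, r), ⟨h, rfl⟩, rfl⟩
    · rintro ⟨⟨ρ', r'⟩, ⟨h, rfl⟩, rfl⟩
      exact h
  have hcomp : IsCompact (roofValues f ρ) := by
    rw [himg]
    exact (hc.inter_right (isClosed_singleton.preimage continuous_fst)).image continuous_snd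
  exact hcomp.isLeast_sInf (roofValues_nonempty f hρ)

theorem roof_nonneg {f : Vec → ℝ} (hf : ∀ ψ, 0 ≤ f ψ) (ρ : Matrix Idx Idx ℂ) :
    0 ≤ roof f ρ := by
  refine Real.sInf_nonneg ?_
  rintro r ⟨m, p, ψ, hp, -, -, -, rfl⟩
  exact Finset.sum_nonneg fun i _ => mul_nonneg (hp i) (hf _)

/-- The convex roof of a nonnegative continuous function vanishes exactly on the convex hull of the
pure states on which the function vanishes. -/
theorem mem_convexHull_iff_roof_eq_zero {f : Vec → ℝ} (hf : Continuous f) (hf0 : ∀ ψ, 0 ≤ f ψ)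
    {ρ : Matrix Idx Idx ℂ} (hρ : ρ ∈ states) :
    ρ ∈ convexHull ℝ (proj '' {ψ | ‖ψ‖ = 1 ∧ f ψ = 0}) ↔ roof f ρ = 0 := by
  constructor
  · intro h
    refine le_antisymm ?_ (roof_nonneg hf0 ρ)
    refine (isLeast_roof hf hρ).2 (mem_roofValues_iff.2 ?_)
    obtain ⟨ι, _, w, z, hw, hw1, hz, rfl⟩ := mem_convexHull_iff_exists_fintype.1 h
    choose ψ hψ hz using hz
    -- A decomposition into zeros of `f` lifts to height zero in the graph of `f`, so zero is an
    -- attained average.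
    refine mem_convexHull_of_exists_fintype w (fun i => (z i, 0)) hw hw1
      (fun i => ⟨ψ i, by simpa using (hψ i).1, Prod.ext (hz i) (hψ i).2⟩) ?_
    ext1
    · simp [Prod.fst_sum]
    · simp [Prod.snd_sum]
  · intro h
    obtain ⟨m, p, ψ, hp, hp1, hψ, hsum, hval⟩ := (isLeast_roof hf hρ).1
    rw [h] at hval
    have hz := (Finset.sum_eq_zero_iff_of_nonneg
      fun i _ => mul_nonneg (hp i) (hf0 (ψ i))).1 hval.symm
    -- A vanishing average of nonnegative terms forces `f (ψ i) = 0` only where `p i ≠ 0`, so terms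
    -- of zero weight are discarded first.
    rw [hsum, ← Finset.sum_filter_of_ne (p := fun i => p i ≠ 0)
      fun i _ hi hpi => hi (by rw [hpi, zero_smul])]
    refine (convex_convexHull ℝ _).sum_mem (fun i _ => hp i) ?_ fun i hi => ?_
    · rw [Finset.sum_filter_ne_zero, hp1]
    · refine subset_convexHull ℝ _ ⟨ψ i, ⟨hψ i, ?_⟩, rfl⟩
      exact (mul_eq_zero.1 (hz i (Finset.mem_univ i))).resolve_left (Finset.mem_filter.1 hi).2

/-! ### The pure states of the PSS subsets -/

/-- The pure states given by the unit vectors with a property `P`, as a union of classes. -/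
theorem image_proj_eq {P : Vec → Prop} {L : SLOCCLabel → Prop}
    (h : ∀ l ψ, HasProfile l ψ → (P ψ ↔ L l)) :
    proj '' {ψ | ‖ψ‖ = 1 ∧ P ψ} = {π | ∃ l, L l ∧ l ≠ .null ∧ π ∈ Q l} := by
  ext π
  constructor
  · rintro ⟨ψ, ⟨h1, hP⟩, rfl⟩
    have h0 : ψ ≠ 0 := by rintro rfl; simp at h1
    obtain ⟨l, hl⟩ := exists_mem_sloccClass ψ
    exact ⟨l, (h l ψ (hasProfile_of_mem_sloccClass hl)).1 hP, by rintro rfl; exact h0 hl, ψ, hl, h1, rfl⟩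
  · rintro ⟨l, hL, -, ψ, hl, h1, rfl⟩
    exact ⟨ψ, ⟨h1, (h l ψ (hasProfile_of_mem_sloccClass hl)).2 hL⟩, rfl⟩

theorem SLOCCLabel.exists_iff {p : SLOCCLabel → Prop} :
    (∃ l, p l) ↔ p .null ∨ p .sep ∨ (∃ a, p (.bisep a)) ∨ p .W ∨ p .GHZ := by
  constructor
  · rintro ⟨_ | _ | a | _ | _, h⟩ <;> grind
  · rintro (h | h | ⟨a, h⟩ | h | h) <;> exact ⟨_, h⟩

theorem PSep_eq : PSep = proj '' {ψ | ‖ψ‖ = 1 ∧ y ψ = 0} := by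
  rw [image_proj_eq (L := fun l => ∀ a, GamVanishes l a) fun l ψ h => by
    simp only [y_eq_zero_iff, h.gam_eq_zero_iff]]
  ext π
  have hb : ∀ b : Fin 3, ¬ ∀ a, a ≠ b := fun b h => h b rfl
  simp only [Set.mem_ofPred_eq, SLOCCLabel.exists_iff, GamVanishes, hb]
  simp [PSep]

theorem PBisep_eq (a : Fin 3) : PBisep a = proj '' {ψ | ‖ψ‖ = 1 ∧ csq a ψ = 0} := by
  rw [image_proj_eq (L := fun l => GamVanishes l (a + 1) ∧ GamVanishes l (a + 2)) fun l ψ h => by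
    simp only [csq_eq_zero_iff, h.gam_eq_zero_iff]]
  ext π
  have hb : ∀ b : Fin 3, (a + 1 ≠ b ∧ a + 2 ≠ b) ↔ b = a := by revert a; decide
  simp only [Set.mem_ofPred_eq, SLOCCLabel.exists_iff, GamVanishes, hb]
  simp [PBisep]

/-- On `bisep b` only `gam b` survives, so the zeros of `g a` include the two biseparable classes
other than `bisep a`. -/
theorem PBisep_union_eq (a : Fin 3) :
    PBisep (a + 1) ∪ PBisep (a + 2) = proj '' {ψ | ‖ψ‖ = 1 ∧ g a ψ = 0} := by
  rw [image_proj_eq (L := fun l => GamVanishes l a) fun l ψ h => by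
    simp only [g_eq_zero_iff, h.gam_eq_zero_iff]]
  ext π
  have hb : ∀ b : Fin 3, a ≠ b ↔ b = a + 1 ∨ b = a + 2 := by revert a; decide
  simp only [Set.mem_ofPred_eq, SLOCCLabel.exists_iff, GamVanishes, hb]
  simp [PBisep, or_and_right, exists_or]
  tauto

theorem iUnion_PBisep_eq : ⋃ a, PBisep a = proj '' {ψ | ‖ψ‖ = 1 ∧ t ψ = 0} := by
  rw [image_proj_eq (L := fun l => l ≠ .W ∧ l ≠ .GHZ) fun l ψ h => by
    simp only [t_eq_zero_iff, h.T_eq_zero_iff]]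
  ext π
  simp [SLOCCLabel.exists_iff, PBisep, exists_or]

theorem PW_eq : PW = proj '' {ψ | ‖ψ‖ = 1 ∧ tauSq ψ = 0} := by
  rw [image_proj_eq (L := fun l => l ≠ .GHZ) fun l ψ h => by
    simp only [tauSq_eq_zero_iff, h.q_eq_zero_iff]]
  ext π
  simp [SLOCCLabel.exists_iff, PW, or_assoc]

theorem proj_mem_PGHZ {ψ : Vec} (h : ‖ψ‖ = 1) : proj ψ ∈ PGHZ := by
  have : proj ψ ∈ proj '' {ψ | ‖ψ‖ = 1 ∧ True} := ⟨ψ, ⟨h, trivial⟩, rfl⟩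
  rw [image_proj_eq (L := fun _ => True) fun _ _ _ => Iff.rfl] at this
  simpa [SLOCCLabel.exists_iff, PGHZ, or_assoc] using this

/-- Every pure state is in `PGHZ`, so spectral decomposition suffices. Among states, the GHZ class
is thus just the complement of `DW`. -/
theorem states_subset_DGHZ : states ⊆ DGHZ := fun ρ hρ => by
  obtain ⟨p, ψ, hp, hp1, hψ, rfl⟩ := exists_eq_sum_proj hρ
  exact mem_convexHull_of_exists_fintype p (fun i => proj (ψ i)) hp hp1
    (fun i => proj_mem_PGHZ (hψ i)) rfl

/-! ### Inclusions between the PSS subsets -/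

theorem DSep_subset_DBisep (a : Fin 3) : DSep ⊆ DBisep a :=
  convexHull_mono Set.subset_union_left

theorem DBisep_subset_DPair {a b : Fin 3} (h : a ≠ b) : DBisep a ⊆ DPair b := by
  have hab : a = b + 1 ∨ a = b + 2 := by revert a b; decide
  rcases hab with rfl | rfl
  · exact convexHull_mono Set.subset_union_left
  · exact convexHull_mono Set.subset_union_right

theorem DPair_subset_DTwoSep (a : Fin 3) : DPair a ⊆ DTwoSep :=
  convexHull_mono (Set.union_subset (Set.subset_iUnion PBisep _) (Set.subset_iUnion PBisep _))

theorem DTwoSep_subset_DW : DTwoSep ⊆ DW := by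
  refine convexHull_mono (Set.iUnion_subset fun a => ?_)
  exact (Set.union_subset_union_right _ (Set.subset_iUnion (fun a => Q (.bisep a)) a)).trans
    Set.subset_union_left

/-! ### Membership criteria -/

theorem y_mem_indicators : y ∈ indicators := by simp [indicators]

theorem t_mem_indicators : t ∈ indicators := by simp [indicators]

theorem tauSq_mem_indicators : tauSq ∈ indicators := by simp [indicators]

theorem csq_mem_indicators (a : Fin 3) : csq a ∈ indicators := by simp [indicators]

theorem g_mem_indicators (a : Fin 3) : g a ∈ indicators := by simp [indicators]

theorem convexHull_criterion {f : Vec → ℝ} (hf : f ∈ indicators) {S : Set (Matrix Idx Idx ℂ)}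
    (hS : S = proj '' {ψ | ‖ψ‖ = 1 ∧ f ψ = 0}) {ρ : Matrix Idx Idx ℂ} (hρ : ρ ∈ states) :
    ρ ∈ convexHull ℝ S ↔ roof f ρ = 0 := by
  rw [hS]
  exact mem_convexHull_iff_roof_eq_zero (indicators_continuous f hf) (indicators_nonneg f hf) hρ

theorem mem_DSep_iff {ρ : Matrix Idx Idx ℂ} (hρ : ρ ∈ states) : ρ ∈ DSep ↔ roof y ρ = 0 :=
  convexHull_criterion y_mem_indicators PSep_eq hρ

theorem mem_DBisep_iff {ρ : Matrix Idx Idx ℂ} (hρ : ρ ∈ states) (a : Fin 3) :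
    ρ ∈ DBisep a ↔ roof (csq a) ρ = 0 :=
  convexHull_criterion (csq_mem_indicators a) (PBisep_eq a) hρ

theorem mem_DPair_iff {ρ : Matrix Idx Idx ℂ} (hρ : ρ ∈ states) (a : Fin 3) :
    ρ ∈ DPair a ↔ roof (g a) ρ = 0 :=
  convexHull_criterion (g_mem_indicators a) (PBisep_union_eq a) hρ

theorem mem_DTwoSep_iff {ρ : Matrix Idx Idx ℂ} (hρ : ρ ∈ states) : ρ ∈ DTwoSep ↔ roof t ρ = 0 :=
  convexHull_criterion t_mem_indicators iUnion_PBisep_eq hρ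

theorem mem_DW_iff {ρ : Matrix Idx Idx ℂ} (hρ : ρ ∈ states) : ρ ∈ DW ↔ roof tauSq ρ = 0 :=
  convexHull_criterion tauSq_mem_indicators PW_eq hρ

theorem roof_pos_iff {f : Vec → ℝ} (hf : f ∈ indicators) (ρ : Matrix Idx Idx ℂ) :
    0 < roof f ρ ↔ ¬ roof f ρ = 0 :=
  (roof_nonneg (indicators_nonneg f hf) ρ).lt_iff_ne'

theorem indicator_pos_iff {f : Vec → ℝ} (hf : f ∈ indicators) (ψ : Vec) :
    0 < f ψ ↔ ¬ f ψ = 0 :=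
  (indicators_nonneg f hf ψ).lt_iff_ne'

theorem n_pos_iff (ψ : Vec) : 0 < n ψ ↔ ¬ ψ = 0 := by
  rw [← n_eq_zero_iff]
  exact (sq_nonneg ‖ψ‖).lt_iff_ne'

theorem hasProfile_iff (l : SLOCCLabel) (ψ : Vec) :
    HasProfile l ψ ↔ (ψ = 0 ↔ l = .null) ∧ (∀ a, gam a ψ = 0 ↔ GamVanishes l a) ∧
      (T ψ = 0 ↔ l ≠ .W ∧ l ≠ .GHZ) ∧ (q ψ = 0 ↔ l ≠ .GHZ) :=
  ⟨fun h => ⟨h.1, h.2, h.3, h.4⟩, fun h => ⟨h.1, h.2.1, h.2.2.1, h.2.2.2⟩⟩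

/-- Each SLOCC class is identified by its row of vanishing and positive indicators. -/
theorem sloccClass_table (ψ : Vec) :
    (ψ ∈ sloccClass .null ↔
      n ψ = 0 ∧ y ψ = 0 ∧ (∀ a, csq a ψ = 0) ∧ (∀ a, g a ψ = 0) ∧ t ψ = 0 ∧ tauSq ψ = 0) ∧
    (ψ ∈ sloccClass .sep ↔
      0 < n ψ ∧ y ψ = 0 ∧ (∀ a, csq a ψ = 0) ∧ (∀ a, g a ψ = 0) ∧ t ψ = 0 ∧ tauSq ψ = 0) ∧
    (∀ a : Fin 3, ψ ∈ sloccClass (.bisep a) ↔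
      0 < n ψ ∧ 0 < y ψ ∧ csq a ψ = 0 ∧ 0 < csq (a + 1) ψ ∧ 0 < csq (a + 2) ψ ∧
      0 < g a ψ ∧ g (a + 1) ψ = 0 ∧ g (a + 2) ψ = 0 ∧ t ψ = 0 ∧ tauSq ψ = 0) ∧
    (ψ ∈ sloccClass .W ↔
      0 < n ψ ∧ 0 < y ψ ∧ (∀ a, 0 < csq a ψ) ∧ (∀ a, 0 < g a ψ) ∧ 0 < t ψ ∧ tauSq ψ = 0) ∧
    (ψ ∈ sloccClass .GHZ ↔
      0 < n ψ ∧ 0 < y ψ ∧ (∀ a, 0 < csq a ψ) ∧ (∀ a, 0 < g a ψ) ∧ 0 < t ψ ∧ 0 < tauSq ψ) := by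
  simp only [mem_sloccClass_iff_hasProfile, hasProfile_iff, n_eq_zero_iff, n_pos_iff,
    indicator_pos_iff y_mem_indicators, indicator_pos_iff t_mem_indicators,
    indicator_pos_iff tauSq_mem_indicators, indicator_pos_iff (csq_mem_indicators _),
    indicator_pos_iff (g_mem_indicators _), y_eq_zero_iff, csq_eq_zero_iff, g_eq_zero_iff,
    t_eq_zero_iff, tauSq_eq_zero_iff]
  -- With the vanishing statements treated as independent propositions, each row becomes a finite
  -- propositional equivalence.
  generalize (ψ = 0) = N
  generalize (T ψ = 0) = T'
  generalize (q ψ = 0) = Q'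
  generalize hG : (fun a => gam a ψ = 0) = G
  simp only [fun a => congrFun hG a, Fin.forall_fin_succ, IsEmpty.forall_iff, and_true]
  have e : ((0 : Fin 2).succ : Fin 3) = 1 ∧ ((0 : Fin 1).succ.succ : Fin 3) = 2 ∧
    (1 + 1 : Fin 3) = 2 ∧ (1 + 2 : Fin 3) = 0 ∧ (2 + 1 : Fin 3) = 0 ∧ (2 + 2 : Fin 3) = 1 := by
    decide
  obtain ⟨e1, e2, e3, e4, e5, e6⟩ := e
  have e7 : ∀ a : Fin 3, 0 + a = a := zero_add
  simp only [e1, e2, e3, e4, e5, e6, e7, GamVanishes]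
  refine ⟨?_, ?_, ⟨?_, ?_, ?_⟩, ?_, ?_⟩ <;> simp <;> tauto

/-! ### The PSS classes -/

/-- The membership of a state in the PSS class `l`, expressed by its membership `S` in `DSep`, `B a`
in `DBisep a`, `P a` in `DPair a`, `D` in `DTwoSep` and `W` in `DW`. -/
def PSSPattern (S : Prop) (B P : Fin 3 → Prop) (D W : Prop) : PSSLabel → Prop
  | .c3 => S
  | .c28 => (B 0 ∧ B 1 ∧ B 2) ∧ ¬ S
  | .c27 a => (B (a + 1) ∧ B (a + 2)) ∧ ¬ B a
  | .c26 a => B a ∧ P a ∧ ¬ (B (a + 1) ∨ B (a + 2))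
  | .c25 a => B a ∧ ¬ P a
  | .c24 => (P 0 ∧ P 1 ∧ P 2) ∧ ¬ (B 0 ∨ B 1 ∨ B 2)
  | .c23 a => (P (a + 1) ∧ P (a + 2)) ∧ ¬ (B a ∨ P a)
  | .c22 a => P a ∧ ¬ (P (a + 1) ∨ P (a + 2))
  | .c21 => D ∧ ¬ (P 0 ∨ P 1 ∨ P 2)
  | .W => W ∧ ¬ D
  | .GHZ => ¬ W

theorem mem_pssClass_iff {ρ : Matrix Idx Idx ℂ} (hρ : ρ ∈ states) (l : PSSLabel) :
    ρ ∈ pssClass l ↔ PSSPattern (ρ ∈ DSep) (fun a => ρ ∈ DBisep a) (fun a => ρ ∈ DPair a)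
      (ρ ∈ DTwoSep) (ρ ∈ DW) l := by
  have h := states_subset_DGHZ hρ
  cases l <;> simp [pssClass, PSSPattern, h, and_assoc, or_assoc]

open Classical in
/-- The label of the PSS class whose pattern is satisfied. -/
def pssLabel (S : Prop) (B P : Fin 3 → Prop) (D W : Prop) : PSSLabel :=
  if S then .c3
  else if B 0 then
    if B 1 then if B 2 then .c28 else .c27 2
    else if B 2 then .c27 1 else if P 0 then .c26 0 else .c25 0
  else if B 1 then
    if B 2 then .c27 0 else if P 1 then .c26 1 else .c25 1
  else if B 2 then
    if P 2 then .c26 2 else .c25 2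
  else if P 0 then
    if P 1 then if P 2 then .c24 else .c23 2
    else if P 2 then .c23 1 else .c22 0
  else if P 1 then
    if P 2 then .c23 0 else .c22 1
  else if P 2 then .c22 2
  else if D then .c21 else if W then .W else .GHZ

section

variable {S : Prop} {B P : Fin 3 → Prop} {D W : Prop}

/-- Describing the pattern as the fibre of a function to labels yields existence and uniqueness
together. The inclusions supply the conditions that the decision tree does not test. -/
theorem pssPattern_iff (hSB : ∀ a, S → B a) (hBP : ∀ a b, a ≠ b → B a → P b)
    (hPD : ∀ a, P a → D) (hDW : D → W) (l : PSSLabel) :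
    PSSPattern S B P D W l ↔ pssLabel S B P D W = l := by
  have h0 := hSB 0
  have h1 := hSB 1
  have h2 := hSB 2
  have h01 := hBP 0 1 (by decide)
  have h02 := hBP 0 2 (by decide)
  have h10 := hBP 1 0 (by decide)
  have h12 := hBP 1 2 (by decide)
  have h20 := hBP 2 0 (by decide)
  have h21 := hBP 2 1 (by decide)
  have p0 := hPD 0
  have p1 := hPD 1
  have p2 := hPD 2
  -- Only the instances at the three qubits are kept, which leaves a finite propositional problem.
  clear hSB hBP hPD
  constructor
  · intro h
    unfold pssLabel
    rcases l with _ | _ | a | a | a | _ | a | a | _ | _ | _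
    all_goals try fin_cases a
    all_goals
      simp [PSSPattern] at h
      grind
  · rintro rfl
    unfold pssLabel
    split_ifs <;> simp [PSSPattern] <;> grind

/-- A row lists every membership, while a class definition lists only some of them; the inclusions
force the rest. -/
theorem pssPattern_table (hSB : ∀ a, S → B a) (hBP : ∀ a b, a ≠ b → B a → P b)
    (hPD : ∀ a, P a → D) (hDW : D → W) :
      (PSSPattern S B P D W .c3 ↔
      S ∧
      (∀ a, B a) ∧
      (∀ a, P a) ∧
      D ∧ W) ∧
    (PSSPattern S B P D W .c28 ↔
      ¬ S ∧
      (∀ a, B a) ∧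
      (∀ a, P a) ∧
      D ∧ W) ∧
    (∀ a : Fin 3, PSSPattern S B P D W (.c27 a) ↔
      ¬ S ∧
      ¬ B a ∧
      B (a + 1) ∧
      B (a + 2) ∧
      P a ∧
      P (a + 1) ∧
      P (a + 2) ∧
      D ∧ W) ∧
    (∀ a : Fin 3, PSSPattern S B P D W (.c26 a) ↔
      ¬ S ∧
      B a ∧
      ¬ B (a + 1) ∧
      ¬ B (a + 2) ∧
      P a ∧
      P (a + 1) ∧
      P (a + 2) ∧
      D ∧ W) ∧
    (∀ a : Fin 3, PSSPattern S B P D W (.c25 a) ↔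
      ¬ S ∧
      B a ∧
      ¬ B (a + 1) ∧
      ¬ B (a + 2) ∧
      ¬ P a ∧
      P (a + 1) ∧
      P (a + 2) ∧
      D ∧ W) ∧
    (PSSPattern S B P D W .c24 ↔
      ¬ S ∧
      (∀ a, ¬ B a) ∧
      (∀ a, P a) ∧
      D ∧ W) ∧
    (∀ a : Fin 3, PSSPattern S B P D W (.c23 a) ↔
      ¬ S ∧
      (∀ b, ¬ B b) ∧
      ¬ P a ∧
      P (a + 1) ∧
      P (a + 2) ∧
      D ∧ W) ∧
    (∀ a : Fin 3, PSSPattern S B P D W (.c22 a) ↔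
      ¬ S ∧
      (∀ b, ¬ B b) ∧
      P a ∧
      ¬ P (a + 1) ∧
      ¬ P (a + 2) ∧
      D ∧ W) ∧
    (PSSPattern S B P D W .c21 ↔
      ¬ S ∧
      (∀ a, ¬ B a) ∧
      (∀ a, ¬ P a) ∧
      D ∧ W) ∧
    (PSSPattern S B P D W .W ↔
      ¬ S ∧
      (∀ a, ¬ B a) ∧
      (∀ a, ¬ P a) ∧
      ¬ D ∧ W) ∧
    (PSSPattern S B P D W .GHZ ↔
      ¬ S ∧
      (∀ a, ¬ B a) ∧
      (∀ a, ¬ P a) ∧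
      ¬ D ∧ ¬ W) := by
  have h0 := hSB 0
  have h1 := hSB 1
  have h2 := hSB 2
  have h01 := hBP 0 1 (by decide)
  have h02 := hBP 0 2 (by decide)
  have h10 := hBP 1 0 (by decide)
  have h12 := hBP 1 2 (by decide)
  have h20 := hBP 2 0 (by decide)
  have h21 := hBP 2 1 (by decide)
  have p0 := hPD 0
  have p1 := hPD 1
  have p2 := hPD 2
  clear hSB hBP hPD
  have hall : ∀ {R : Fin 3 → Prop}, (∀ a, R a) ↔ R 0 ∧ R 1 ∧ R 2 := fun {R} =>
    ⟨fun h => ⟨h 0, h 1, h 2⟩, fun h a => by fin_cases a <;> simp [h]⟩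
  refine ⟨?_, ?_, fun a => ?_, fun a => ?_, fun a => ?_, ?_, fun a => ?_, fun a => ?_, ?_, ?_, ?_⟩
  all_goals try fin_cases a
  all_goals
    simp [PSSPattern, hall]
    grind

end

end

end ThreeQubit

theorem mainTheorem4 :
    -- the functions are LU-invariant, depend only on the pure state, and are nonnegative
    (∀ f ∈ ThreeQubit.indicators,
      (∀ U V W : Matrix.unitaryGroup (Fin 2) ℂ, ∀ ψ,
        f (ThreeQubit.localAct U.val V.val W.val ψ) = f ψ) ∧
      (∀ ψ φ, ThreeQubit.proj ψ = ThreeQubit.proj φ → f ψ = f φ) ∧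
      (∀ ψ, 0 ≤ f ψ)) ∧
    -- the seven sets of vectors are the SLOCC classes
    ((∀ ψ, ∃! l, ψ ∈ ThreeQubit.sloccClass l) ∧
      (∀ l, ∀ ψ ∈ ThreeQubit.sloccClass l, ∀ φ,
        φ ∈ ThreeQubit.sloccClass l ↔ ThreeQubit.SLOCCEquiv ψ φ)) ∧
    -- identification of the SLOCC classes of vectors
    (∀ ψ : ThreeQubit.Vec,
      (ψ ∈ ThreeQubit.sloccClass .null ↔
        ThreeQubit.n ψ = 0 ∧ ThreeQubit.y ψ = 0 ∧ (∀ a, ThreeQubit.csq a ψ = 0) ∧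
        (∀ a, ThreeQubit.g a ψ = 0) ∧ ThreeQubit.t ψ = 0 ∧ ThreeQubit.tauSq ψ = 0) ∧
      (ψ ∈ ThreeQubit.sloccClass .sep ↔
        0 < ThreeQubit.n ψ ∧ ThreeQubit.y ψ = 0 ∧ (∀ a, ThreeQubit.csq a ψ = 0) ∧
        (∀ a, ThreeQubit.g a ψ = 0) ∧ ThreeQubit.t ψ = 0 ∧ ThreeQubit.tauSq ψ = 0) ∧
      (∀ a : Fin 3, ψ ∈ ThreeQubit.sloccClass (.bisep a) ↔
        0 < ThreeQubit.n ψ ∧ 0 < ThreeQubit.y ψ ∧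
        ThreeQubit.csq a ψ = 0 ∧ 0 < ThreeQubit.csq (a + 1) ψ ∧ 0 < ThreeQubit.csq (a + 2) ψ ∧
        0 < ThreeQubit.g a ψ ∧ ThreeQubit.g (a + 1) ψ = 0 ∧ ThreeQubit.g (a + 2) ψ = 0 ∧
        ThreeQubit.t ψ = 0 ∧ ThreeQubit.tauSq ψ = 0) ∧
      (ψ ∈ ThreeQubit.sloccClass .W ↔
        0 < ThreeQubit.n ψ ∧ 0 < ThreeQubit.y ψ ∧ (∀ a, 0 < ThreeQubit.csq a ψ) ∧
        (∀ a, 0 < ThreeQubit.g a ψ) ∧ 0 < ThreeQubit.t ψ ∧ ThreeQubit.tauSq ψ = 0) ∧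
      (ψ ∈ ThreeQubit.sloccClass .GHZ ↔
        0 < ThreeQubit.n ψ ∧ 0 < ThreeQubit.y ψ ∧ (∀ a, 0 < ThreeQubit.csq a ψ) ∧
        (∀ a, 0 < ThreeQubit.g a ψ) ∧ 0 < ThreeQubit.t ψ ∧ 0 < ThreeQubit.tauSq ψ)) ∧
    (∀ ρ ∈ ThreeQubit.states,
      -- the minima defining the convex roofs exist
      (∀ f ∈ ThreeQubit.indicators,
        IsLeast (ThreeQubit.roofValues f ρ) (ThreeQubit.roof f ρ)) ∧
      -- criteria for the PSS subsets
      ((ρ ∈ ThreeQubit.DSep ↔ ThreeQubit.roof ThreeQubit.y ρ = 0) ∧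
        (∀ a, ρ ∈ ThreeQubit.DBisep a ↔ ThreeQubit.roof (ThreeQubit.csq a) ρ = 0) ∧
        (∀ a, ρ ∈ ThreeQubit.DPair a ↔ ThreeQubit.roof (ThreeQubit.g a) ρ = 0) ∧
        (ρ ∈ ThreeQubit.DTwoSep ↔ ThreeQubit.roof ThreeQubit.t ρ = 0) ∧
        (ρ ∈ ThreeQubit.DW ↔ ThreeQubit.roof ThreeQubit.tauSq ρ = 0)) ∧
      -- each state belongs to exactly one of the 21 PSS classes
      (∃! l, ρ ∈ ThreeQubit.pssClass l) ∧
      -- criteria for the PSS classes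
      (ρ ∈ ThreeQubit.pssClass .c3 ↔
        ThreeQubit.roof ThreeQubit.y ρ = 0 ∧
        (∀ a, ThreeQubit.roof (ThreeQubit.csq a) ρ = 0) ∧
        (∀ a, ThreeQubit.roof (ThreeQubit.g a) ρ = 0) ∧
        ThreeQubit.roof ThreeQubit.t ρ = 0 ∧ ThreeQubit.roof ThreeQubit.tauSq ρ = 0) ∧
      (ρ ∈ ThreeQubit.pssClass .c28 ↔
        0 < ThreeQubit.roof ThreeQubit.y ρ ∧
        (∀ a, ThreeQubit.roof (ThreeQubit.csq a) ρ = 0) ∧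
        (∀ a, ThreeQubit.roof (ThreeQubit.g a) ρ = 0) ∧
        ThreeQubit.roof ThreeQubit.t ρ = 0 ∧ ThreeQubit.roof ThreeQubit.tauSq ρ = 0) ∧
      (∀ a : Fin 3, ρ ∈ ThreeQubit.pssClass (.c27 a) ↔
        0 < ThreeQubit.roof ThreeQubit.y ρ ∧
        0 < ThreeQubit.roof (ThreeQubit.csq a) ρ ∧
        ThreeQubit.roof (ThreeQubit.csq (a + 1)) ρ = 0 ∧
        ThreeQubit.roof (ThreeQubit.csq (a + 2)) ρ = 0 ∧
        ThreeQubit.roof (ThreeQubit.g a) ρ = 0 ∧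
        ThreeQubit.roof (ThreeQubit.g (a + 1)) ρ = 0 ∧
        ThreeQubit.roof (ThreeQubit.g (a + 2)) ρ = 0 ∧
        ThreeQubit.roof ThreeQubit.t ρ = 0 ∧ ThreeQubit.roof ThreeQubit.tauSq ρ = 0) ∧
      (∀ a : Fin 3, ρ ∈ ThreeQubit.pssClass (.c26 a) ↔
        0 < ThreeQubit.roof ThreeQubit.y ρ ∧
        ThreeQubit.roof (ThreeQubit.csq a) ρ = 0 ∧
        0 < ThreeQubit.roof (ThreeQubit.csq (a + 1)) ρ ∧
        0 < ThreeQubit.roof (ThreeQubit.csq (a + 2)) ρ ∧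
        ThreeQubit.roof (ThreeQubit.g a) ρ = 0 ∧
        ThreeQubit.roof (ThreeQubit.g (a + 1)) ρ = 0 ∧
        ThreeQubit.roof (ThreeQubit.g (a + 2)) ρ = 0 ∧
        ThreeQubit.roof ThreeQubit.t ρ = 0 ∧ ThreeQubit.roof ThreeQubit.tauSq ρ = 0) ∧
      (∀ a : Fin 3, ρ ∈ ThreeQubit.pssClass (.c25 a) ↔
        0 < ThreeQubit.roof ThreeQubit.y ρ ∧
        ThreeQubit.roof (ThreeQubit.csq a) ρ = 0 ∧
        0 < ThreeQubit.roof (ThreeQubit.csq (a + 1)) ρ ∧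
        0 < ThreeQubit.roof (ThreeQubit.csq (a + 2)) ρ ∧
        0 < ThreeQubit.roof (ThreeQubit.g a) ρ ∧
        ThreeQubit.roof (ThreeQubit.g (a + 1)) ρ = 0 ∧
        ThreeQubit.roof (ThreeQubit.g (a + 2)) ρ = 0 ∧
        ThreeQubit.roof ThreeQubit.t ρ = 0 ∧ ThreeQubit.roof ThreeQubit.tauSq ρ = 0) ∧
      (ρ ∈ ThreeQubit.pssClass .c24 ↔
        0 < ThreeQubit.roof ThreeQubit.y ρ ∧
        (∀ a, 0 < ThreeQubit.roof (ThreeQubit.csq a) ρ) ∧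
        (∀ a, ThreeQubit.roof (ThreeQubit.g a) ρ = 0) ∧
        ThreeQubit.roof ThreeQubit.t ρ = 0 ∧ ThreeQubit.roof ThreeQubit.tauSq ρ = 0) ∧
      (∀ a : Fin 3, ρ ∈ ThreeQubit.pssClass (.c23 a) ↔
        0 < ThreeQubit.roof ThreeQubit.y ρ ∧
        (∀ b, 0 < ThreeQubit.roof (ThreeQubit.csq b) ρ) ∧
        0 < ThreeQubit.roof (ThreeQubit.g a) ρ ∧
        ThreeQubit.roof (ThreeQubit.g (a + 1)) ρ = 0 ∧
        ThreeQubit.roof (ThreeQubit.g (a + 2)) ρ = 0 ∧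
        ThreeQubit.roof ThreeQubit.t ρ = 0 ∧ ThreeQubit.roof ThreeQubit.tauSq ρ = 0) ∧
      (∀ a : Fin 3, ρ ∈ ThreeQubit.pssClass (.c22 a) ↔
        0 < ThreeQubit.roof ThreeQubit.y ρ ∧
        (∀ b, 0 < ThreeQubit.roof (ThreeQubit.csq b) ρ) ∧
        ThreeQubit.roof (ThreeQubit.g a) ρ = 0 ∧
        0 < ThreeQubit.roof (ThreeQubit.g (a + 1)) ρ ∧
        0 < ThreeQubit.roof (ThreeQubit.g (a + 2)) ρ ∧
        ThreeQubit.roof ThreeQubit.t ρ = 0 ∧ ThreeQubit.roof ThreeQubit.tauSq ρ = 0) ∧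
      (ρ ∈ ThreeQubit.pssClass .c21 ↔
        0 < ThreeQubit.roof ThreeQubit.y ρ ∧
        (∀ a, 0 < ThreeQubit.roof (ThreeQubit.csq a) ρ) ∧
        (∀ a, 0 < ThreeQubit.roof (ThreeQubit.g a) ρ) ∧
        ThreeQubit.roof ThreeQubit.t ρ = 0 ∧ ThreeQubit.roof ThreeQubit.tauSq ρ = 0) ∧
      (ρ ∈ ThreeQubit.pssClass .W ↔
        0 < ThreeQubit.roof ThreeQubit.y ρ ∧
        (∀ a, 0 < ThreeQubit.roof (ThreeQubit.csq a) ρ) ∧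
        (∀ a, 0 < ThreeQubit.roof (ThreeQubit.g a) ρ) ∧
        0 < ThreeQubit.roof ThreeQubit.t ρ ∧ ThreeQubit.roof ThreeQubit.tauSq ρ = 0) ∧
      (ρ ∈ ThreeQubit.pssClass .GHZ ↔
        0 < ThreeQubit.roof ThreeQubit.y ρ ∧
        (∀ a, 0 < ThreeQubit.roof (ThreeQubit.csq a) ρ) ∧
        (∀ a, 0 < ThreeQubit.roof (ThreeQubit.g a) ρ) ∧
        0 < ThreeQubit.roof ThreeQubit.t ρ ∧ 0 < ThreeQubit.roof ThreeQubit.tauSq ρ)) := by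
  refine ⟨fun f hf => ⟨ThreeQubit.indicators_localAct_unitary f hf,
    ThreeQubit.indicators_eq_of_proj_eq f hf, ThreeQubit.indicators_nonneg f hf⟩,
    ⟨ThreeQubit.existsUnique_mem_sloccClass,
      fun l ψ h φ => ThreeQubit.mem_sloccClass_iff_sloccEquiv h φ⟩,
    ThreeQubit.sloccClass_table, fun ρ hρ => ?_⟩
  have hSB := fun a (h : ρ ∈ ThreeQubit.DSep) => ThreeQubit.DSep_subset_DBisep a h
  have hBP := fun a b hab (h : ρ ∈ ThreeQubit.DBisep a) =>
    ThreeQubit.DBisep_subset_DPair (b := b) hab h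
  have hPD := fun a (h : ρ ∈ ThreeQubit.DPair a) => ThreeQubit.DPair_subset_DTwoSep a h
  have hDW := fun (h : ρ ∈ ThreeQubit.DTwoSep) => ThreeQubit.DTwoSep_subset_DW h
  refine ⟨fun f hf => ThreeQubit.isLeast_roof (ThreeQubit.indicators_continuous f hf) hρ,
    ⟨ThreeQubit.mem_DSep_iff hρ, ThreeQubit.mem_DBisep_iff hρ, ThreeQubit.mem_DPair_iff hρ,
      ThreeQubit.mem_DTwoSep_iff hρ, ThreeQubit.mem_DW_iff hρ⟩, ?_, ?_⟩
  -- Membership in class `l` becomes equality of `l` with one fixed label.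
  · simp only [ThreeQubit.mem_pssClass_iff hρ, ThreeQubit.pssPattern_iff hSB hBP hPD hDW]
    exact existsUnique_eq'
  -- Roofs are nonnegative, so positivity means nonvanishing, that is, nonmembership in the
  -- corresponding convex set; the table is then the propositional one.
  · simp only [ThreeQubit.mem_pssClass_iff hρ,
      ThreeQubit.roof_pos_iff ThreeQubit.y_mem_indicators,
      ThreeQubit.roof_pos_iff ThreeQubit.t_mem_indicators,
      ThreeQubit.roof_pos_iff ThreeQubit.tauSq_mem_indicators,
      ThreeQubit.roof_pos_iff (ThreeQubit.csq_mem_indicators _),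
      ThreeQubit.roof_pos_iff (ThreeQubit.g_mem_indicators _),
      ← ThreeQubit.mem_DSep_iff hρ, ← ThreeQubit.mem_DBisep_iff hρ, ← ThreeQubit.mem_DPair_iff hρ,
      ← ThreeQubit.mem_DTwoSep_iff hρ, ← ThreeQubit.mem_DW_iff hρ]
    exact ThreeQubit.pssPattern_table hSB hBP hPD hDW
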